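/- **Model.** Let $A\subseteq\mathbb R$ be a measurable symmetric set ($A=-A$), and let $dx$ denote a reference measure on $\mathbb R$ that is invariant under $x\mapsto -x$ (Lebesgue measure for continuous outcomes, counting measure for discrete outcomes). Let $f:A\times\mathbb R\to[0,\infty)$, measurable in $x$, be *valid*: 1. $\int_A f(x;y)\,dx=1$ for all $y\in\mathbb R$; 2. $f(x;y)=f(-x;-y)$ for all $x\in A$, $y\in\mathbb R$; 3. for $x\in A$ with $x<0$, $f(x;\cdot)$ is decreasing and $f(x;y)\to0$ as $y\to\infty$; 4. $\sup_{y\in\mathbb R}f(x;y)<\infty$ for every $x\in A$. Assume also that $f$ is *strictly log-concave* in $y$: $f>0$, and for each $x\in A$ the function $y\mapsto\log f(x;y)$ is twice differentiable with $\frac{\partial^2}{\partial y^2}\log f(x;y)<0$ for all $y\in\mathbb R$. Put $g(x;y)=\frac{\partial}{\partial y}\log f(x;y)$ and $g_2=\frac{\partial g}{\partial y}$. Fix an integer $T\ge1$. For each $n$ let $p_n\in[0,1]$, and let $\mathbf u=\mathbf u^{(n)}\in\mathbb R^n$ be the true score vector, normalized by $u_1=0$. For $1\le i<j\le n$ the number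 of comparisons is $n_{ij}\sim\mathrm{Bin}(T,p_n)$, and the outcomes $X_{ij}^{(t)}$ ($1\le t\le n_{ij}$) have density (mass function) $f(\cdot\,;u_i-u_j)$. For each $n$ all these variables are independent (that is, the counts are independent and, given the counts, the outcomes are independent). The data for all $n$ live on one probability space, with arbitrary dependence between different $n$. The maximum likelihood estimator (MLE) $\hat{\mathbf u}=\hat{\mathbf u}^{(n)}$ is a maximizer over $\{\mathbf v\in\mathbb R^n: v_1=0\}$ of $$l(\mathbf v)=\sum_{1\le i<j\le n}\ \sum_{t=1}^{n_{ij}}\log f\big(X_{ij}^{(t)};v_i-v_j\big).$$ Let $M_n=\max_{i,j}|u_i-u_j|$ and $$C_n^{(2)}=\sup_{x\in A,\,|y|\le M_n}|g(x;y)|,\qquad C_n^{(3)}=\sup_{x\in A,\,|y|\le M_n+1}|g_2(x;y)|,\qquad C_n^{(4)}=\inf_{x\in A,\,|y|\le M_n+1}|g_2(x;y)|.$$ **Statement.** Suppose that $\sup_nM_n<\infty$, that $C_n^{(2)}<\infty$, $C_n^{(3)}<\infty$ and $C_n^{(4)}>0$ for every $n$, and that $p_n\gtrsim(\log n)^3/n$,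 i.e. there is a constant $K$ with $(\log n)^3/n\le Kp_n$ for all sufficiently large $n$. Then there is a (deterministic) constant $C$, independent of $n$, such that almost surely: for all but finitely many $n$ the MLE $\hat{\mathbf u}$ exists and is unique; it is uniformly consistent, $\|\hat{\mathbf u}-\mathbf u\|_\infty\to0$ as $n\to\infty$; and $$\|\hat{\mathbf u}-\mathbf u\|_\infty\le\frac{C}{\log\log n}\qquad\text{for all but finitely many }n.$$ -/

import Mathlib

open MeasureTheory ProbabilityTheory Filter Topology

noncomputable section

namespace PairwiseComparison

/-- `f : A × ℝ → ℝ` is a valid pairwise comparison model with outcome set `A ⊆ ℝ`. The measure `ν`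
is the one written `dx`: Lebesgue measure for a density, counting measure for a mass function.
Only the values `f x y` with `x ∈ A` matter. -/
structure IsValid (ν : Measure ℝ) (A : Set ℝ) (f : ℝ → ℝ → ℝ) : Prop where
  measurableSet : MeasurableSet A
  neg_mem : ∀ x ∈ A, -x ∈ A
  measurable : ∀ y, Measurable fun x : A => f x y
  nonneg : ∀ x ∈ A, ∀ y, 0 ≤ f x y
  integral_eq_one : ∀ y, ∫ x in A, f x y ∂ν = 1
  even : ∀ x ∈ A, ∀ y, f x y = f (-x) (-y)
  antitone : ∀ x ∈ A, x < 0 → Antitone (f x)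
  tendsto_zero : ∀ x ∈ A, x < 0 → Tendsto (f x) atTop (𝓝 0)
  bounded : ∀ x ∈ A, BddAbove (Set.range (f x))

/-- `g(x; y) = ∂/∂y log f(x; y)`. -/
def score (f : ℝ → ℝ → ℝ) (x y : ℝ) : ℝ := deriv (fun z => Real.log (f x z)) y

/-- `g₂(x; y) = ∂/∂y g(x; y)`. -/
def score₂ (f : ℝ → ℝ → ℝ) (x y : ℝ) : ℝ := deriv (score f x) y

/-- `f` is positive, and `log f(x; ·)` is twice differentiable with negative second derivative. -/
structure StrictlyLogConcave (A : Set ℝ) (f : ℝ → ℝ → ℝ) : Prop where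
  pos : ∀ x ∈ A, ∀ y, 0 < f x y
  differentiable_log : ∀ x ∈ A, Differentiable ℝ fun y => Real.log (f x y)
  differentiable_score : ∀ x ∈ A, Differentiable ℝ (score f x)
  score₂_neg : ∀ x ∈ A, ∀ y, score₂ f x y < 0

/-- `C⁽²⁾ = sup {|g(x; y)| : x ∈ A, |y| ≤ M}`, possibly infinite. -/
def C2 (A : Set ℝ) (f : ℝ → ℝ → ℝ) (M : ℝ) : ENNReal :=
  ⨆ (x : ℝ) (_ : x ∈ A) (y : ℝ) (_ : |y| ≤ M), ENNReal.ofReal |score f x y|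

/-- `C⁽³⁾ = sup {|g₂(x; y)| : x ∈ A, |y| ≤ M + 1}`, possibly infinite. -/
def C3 (A : Set ℝ) (f : ℝ → ℝ → ℝ) (M : ℝ) : ENNReal :=
  ⨆ (x : ℝ) (_ : x ∈ A) (y : ℝ) (_ : |y| ≤ M + 1), ENNReal.ofReal |score₂ f x y|

/-- `C⁽⁴⁾ = inf {|g₂(x; y)| : x ∈ A, |y| ≤ M + 1}`. -/
def C4 (A : Set ℝ) (f : ℝ → ℝ → ℝ) (M : ℝ) : ENNReal :=
  ⨅ (x : ℝ) (_ : x ∈ A) (y : ℝ) (_ : |y| ≤ M + 1), ENNReal.ofReal |score₂ f x y|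

/-- The dynamic range `max_{i,j} |u_i - u_j|` of a score vector. -/
def dynamicRange {n : ℕ} (u : Fin n → ℝ) : ℝ := ⨆ i, ⨆ j, |u i - u j|

/-- The law of one comparison outcome at relative score `y`: density `f(·; y)` on `A`. -/
def outcomeLaw (ν : Measure ℝ) (A : Set ℝ) (f : ℝ → ℝ → ℝ) (y : ℝ) : Measure ℝ :=
  (ν.restrict A).withDensity fun x => ENNReal.ofReal (f x y)

/-- The unordered pairs of subjects, listed as ordered pairs `i < j`. -/
abbrev Pairs (n : ℕ) : Type := {e : Fin n × Fin n // e.1 < e.2}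

/-- The data of the comparison model on `n` subjects with true scores `u`: for `i < j`,
`N i j` is the number of comparisons of `i` and `j`, with law `Bin(T, p)`, and `X i j t` is the
outcome of the `t`-th one, with density `f(·; u_i - u_j)`; only the outcomes with index
`t < N i j` are observed. All counts and all outcomes are independent. -/
structure IsComparisonData {Ω : Type*} [MeasurableSpace Ω] (P : Measure Ω) (ν : Measure ℝ)
    (A : Set ℝ) (f : ℝ → ℝ → ℝ) (T : ℕ) (p : unitInterval) {n : ℕ} (u : Fin n → ℝ)
    (N : Fin n → Fin n → Ω → ℕ) (X : Fin n → Fin n → Fin T → Ω → ℝ) : Prop where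
  count_law : ∀ i j, i < j → HasLaw (N i j) (binomial T p) P
  outcome_law : ∀ i j, i < j → ∀ t, HasLaw (X i j t) (outcomeLaw ν A f (u i - u j)) P
  indep : iIndepFun
    (Sum.elim (fun (e : Pairs n) (ω : Ω) => (N e.1.1 e.1.2 ω : ℝ))
      (fun (a : Pairs n × Fin T) (ω : Ω) => X a.1.1.1 a.1.1.2 a.2 ω)) P

/-- The conditional log-likelihood `l(v) = ∑_{i<j} ∑_{t ≤ n_ij} log f(X_ij^(t); v_i - v_j)` of
realized counts `N` and outcomes `X`. -/
def logLik (f : ℝ → ℝ → ℝ) {n T : ℕ} (N : Fin n → Fin n → ℕ) (X : Fin n → Fin n → Fin T → ℝ)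
    (v : Fin n → ℝ) : ℝ :=
  ∑ e : Pairs n, ∑ t ∈ Finset.univ.filter (fun t : Fin T => (t : ℕ) < N e.1.1 e.1.2),
    Real.log (f (X e.1.1 e.1.2 t) (v e.1.1 - v e.1.2))

/-- The normalized score vectors: those whose first coordinate is `0`. -/
def normalized (n : ℕ) : Set (Fin n → ℝ) := {v | ∀ i : Fin n, (i : ℕ) = 0 → v i = 0}

/-- `v` is a maximum likelihood estimator: it maximizes `l` over all vectors with `v_1 = 0`. -/
def IsMLE (f : ℝ → ℝ → ℝ) {n T : ℕ} (N : Fin n → Fin n → ℕ) (X : Fin n → Fin n → Fin T → ℝ)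
    (v : Fin n → ℝ) : Prop :=
  v ∈ normalized n ∧ ∀ w ∈ normalized n, logLik f N X w ≤ logLik f N X v

end PairwiseComparison

end

open MeasureTheory ProbabilityTheory Filter Topology

noncomputable section

namespace PairwiseComparison

/-! Write `d = n p`, `ℓ = log n`, and let `u + h` maximize the likelihood over the vectors within
1/4 of `u` in the sup norm. Take a superlevel set `U = {h ≥ m}` and lower `h` on `U` by `lam = 1/ℓ`:
the likelihood does not increase. Concavity compares this change, pair by pair, with the effect of
raising the true scores by `lam` on `U`. The comparison costs `c₅ lam²` per observed comparison
leaving `U` and gains `c₄ lam η` per comparison from `U` to a vertex with `h < m - η`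
(`cut_le_of_pairSum_le`).

The raised vector is deterministic, so its likelihood ratio against the truth has mean one; Markov's
inequality and a union bound over `U` bound the log-ratio by `3ℓ|U|`. Chernoff bounds show that at
most `(2T+1)d|U|` comparisons leave `U`, and that at least `d|U|/16` of them reach `{h < m - η}`,
unless `{h ≥ m - η}` exceeds `U` by more than `ℓ|U|` or `n/4` vertices. Since `d ≥ ℓ³/K`, taking `η
= C/ℓ` with `C` large leaves only this growth (`IsExpanding.lt_card_superlevel`).

Hence about `ℓ / log ℓ` steps of size `η` lead from any vertex down to a level reached by more than
half of the vertices. The same holds for `-h`, and two majorities meet, so `h` oscillates by `O(1 /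
log ℓ)` (`IsExpanding.sub_le`). This is small against the box, so the normalized maximizer is a
local, and by concavity a global, maximizer. Expansion also makes the comparison graph connected,
which with strict concavity gives uniqueness. The exceptional events have probability at most
`12/n²` (`IsComparisonData.measure_not_isExpanding_le`), and the first Borel–Cantelli lemma works
under any dependence between different `n`. -/

/-! ### Cuts and the basic comparison inequality -/

open scoped Classical in
/-- The total weight of the pairs that join `U` to `V`. -/
def cut {n : ℕ} (k : Pairs n → ℝ) (U V : Finset (Fin n)) : ℝ :=
  ∑ e : Pairs n, if e.1.1 ∈ U ∧ e.1.2 ∈ V ∨ e.1.2 ∈ U ∧ e.1.1 ∈ V then k e else 0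

/-- A log-likelihood: a sum over the pairs of functions of the relative score. -/
def pairSum {n : ℕ} (ψ : Pairs n → ℝ → ℝ) (v : Fin n → ℝ) : ℝ :=
  ∑ e : Pairs n, ψ e (v e.1.1 - v e.1.2)

/-- The vector `c • 1_U`. -/
def bump {n : ℕ} (U : Finset (Fin n)) (c : ℝ) (i : Fin n) : ℝ := if i ∈ U then c else 0

/-- A quantitative concavity property of `ψ` near `y`, with weight `k`. -/
def CurvedAt (ψ : ℝ → ℝ) (k y lam c₅ c₄ : ℝ) : Prop :=
  ∀ o : ℝ, (o = 1 ∨ o = -1) → ∀ s : ℝ, 0 ≤ s → s ≤ 1 / 2 →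
    ψ (y + o * s) - ψ (y + o * (s - lam)) ≤
      ψ (y + o * lam) - ψ y + k * lam * (c₅ * lam - c₄ * s)

/-- If lowering `h` on `U` does not increase the likelihood, then the weight of the pairs from `U`
to the vertices far below `U` is small. -/
lemma cut_le_of_pairSum_le {n : ℕ} {k : Pairs n → ℝ} {ψ : Pairs n → ℝ → ℝ} {u h : Fin n → ℝ}
    {lam c₅ c₄ η σ : ℝ} (hk : ∀ e, 0 ≤ k e) (hlam : 0 ≤ lam) (hc₄ : 0 ≤ c₄)
    (hσ : σ = 1 ∨ σ = -1)
    (hψ : ∀ e : Pairs n, CurvedAt (ψ e) (k e) (u e.1.1 - u e.1.2) lam c₅ c₄)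
    {U V : Finset (Fin n)} (hUV : Disjoint U V)
    (h0 : ∀ i ∈ U, ∀ j ∉ U, 0 ≤ σ * (h i - h j)) (h1 : ∀ i ∈ U, ∀ j ∉ U, σ * (h i - h j) ≤ 1 / 2)
    (hη : ∀ i ∈ U, ∀ j ∈ V, η ≤ σ * (h i - h j))
    (hmax : pairSum ψ (u + (h - bump U (σ * lam))) ≤ pairSum ψ (u + h)) :
    c₄ * lam * η * cut k U V ≤
      pairSum ψ (u + bump U (σ * lam)) - pairSum ψ u + c₅ * lam ^ 2 * cut k U Uᶜ := by
  classical
  have hσ2 : σ * σ = 1 := by rcases hσ with rfl | rfl <;> norm_num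
  -- Only pairs with exactly one endpoint in `U` feel the shift. For those, `CurvedAt` is applied in
  -- the direction that points into `U`: `σ` if the first endpoint lies in `U`, `-σ` if the second
  -- does.
  have key : ∀ e : Pairs n,
      ψ e ((u + h) e.1.1 - (u + h) e.1.2)
        - ψ e ((u + (h - bump U (σ * lam))) e.1.1 - (u + (h - bump U (σ * lam))) e.1.2) ≤
      ψ e ((u + bump U (σ * lam)) e.1.1 - (u + bump U (σ * lam)) e.1.2) - ψ e (u e.1.1 - u e.1.2)
        + c₅ * lam ^ 2 * (if e.1.1 ∈ U ∧ e.1.2 ∈ Uᶜ ∨ e.1.2 ∈ U ∧ e.1.1 ∈ Uᶜ then k e else 0)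
        - c₄ * lam * η * (if e.1.1 ∈ U ∧ e.1.2 ∈ V ∨ e.1.2 ∈ U ∧ e.1.1 ∈ V then k e else 0) := by
    intro e
    obtain ⟨⟨i, j⟩, hij⟩ := e
    set e : Pairs n := ⟨(i, j), hij⟩
    have hke := hk e
    simp only [Pi.add_apply, Pi.sub_apply, bump, Finset.mem_compl]
    by_cases hi : i ∈ U <;> by_cases hj : j ∈ U
    · have hi' : i ∉ V := Finset.disjoint_left.1 hUV hi
      have hj' : j ∉ V := Finset.disjoint_left.1 hUV hj
      have e1 : u i + (h i - σ * lam) - (u j + (h j - σ * lam)) = u i + h i - (u j + h j) := by ring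
      have e2 : u i + σ * lam - (u j + σ * lam) = u i - u j := by ring
      simp [hi, hj, hi', hj', e, e1, e2]
    · have hs := hψ e σ hσ (σ * (h i - h j)) (h0 i hi j hj) (h1 i hi j hj)
      have e1 : u i - u j + σ * (σ * (h i - h j)) = u i + h i - (u j + h j) := by
        rw [← mul_assoc, hσ2]; ring
      have e2 : u i - u j + σ * (σ * (h i - h j) - lam)
          = u i + (h i - σ * lam) - (u j + (h j - 0)) := by
        rw [mul_sub, ← mul_assoc, hσ2]; ring
      have e3 : u i - u j + σ * lam = u i + σ * lam - (u j + 0) := by ring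
      simp only [e] at hs
      rw [e1, e2, e3] at hs
      simp only [sub_zero, add_zero] at hs
      by_cases hjV : j ∈ V
      · have := hη i hi j hjV
        simp only [hi, hj, hjV, if_true, if_false, e]
        have : k e * lam * (c₄ * η) ≤ k e * lam * (c₄ * (σ * (h i - h j))) := by gcongr
        simp [e] at this ⊢
        linarith
      · have hi' : i ∉ V := Finset.disjoint_left.1 hUV hi
        simp only [hi, hj, hi', hjV, if_true, if_false, e]
        have : 0 ≤ k e * lam * (c₄ * (σ * (h i - h j))) := by
          have := h0 i hi j hj
          positivity
        simp [e] at this ⊢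
        linarith
    · have hs := hψ e (-σ) (by rcases hσ with rfl | rfl <;> simp) (σ * (h j - h i))
        (h0 j hj i hi) (h1 j hj i hi)
      have e1 : u i - u j + -σ * (σ * (h j - h i)) = u i + h i - (u j + h j) := by
        rw [← mul_assoc, neg_mul, hσ2]; ring
      have e2 : u i - u j + -σ * (σ * (h j - h i) - lam)
          = u i + (h i - 0) - (u j + (h j - σ * lam)) := by
        rw [mul_sub, ← mul_assoc, neg_mul, hσ2]; ring
      have e3 : u i - u j + -σ * lam = u i + 0 - (u j + σ * lam) := by ring
      simp only [e] at hs
      rw [e1, e2, e3] at hs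
      simp only [sub_zero, add_zero] at hs
      by_cases hiV : i ∈ V
      · have := hη j hj i hiV
        simp only [hi, hj, hiV, if_true, if_false, e]
        have : k e * lam * (c₄ * η) ≤ k e * lam * (c₄ * (σ * (h j - h i))) := by gcongr
        simp [e] at this ⊢
        linarith
      · have hj' : j ∉ V := Finset.disjoint_left.1 hUV hj
        simp only [hi, hj, hj', hiV, if_true, if_false, e]
        have : 0 ≤ k e * lam * (c₄ * (σ * (h j - h i))) := by
          have := h0 j hj i hi
          positivity
        simp [e] at this ⊢
        linarith
    · simp [hi, hj, e]
  have := Finset.sum_le_sum fun e (_ : e ∈ Finset.univ) => key e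
  simp only [Finset.sum_sub_distrib, Finset.sum_add_distrib, ← Finset.mul_sum] at this
  simp only [pairSum, cut] at hmax ⊢
  linarith

/-- The properties of the random data at one `n` that give the error bound. -/
structure IsExpanding {n : ℕ} (k : Pairs n → ℝ) (ψ : Pairs n → ℝ → ℝ) (u : Fin n → ℝ)
    (lam L α β γ : ℝ) : Prop where
  le_cut : ∀ U W : Finset (Fin n), U.Nonempty → 2 * U.card ≤ n → Disjoint U W →
    4 * W.card ≤ n → (W.card : ℝ) ≤ U.card * L → α * U.card ≤ cut k U (U ∪ W)ᶜ
  cut_le : ∀ U : Finset (Fin n), U.Nonempty → cut k U Uᶜ ≤ β * U.card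
  pairSum_le : ∀ σ : ℝ, (σ = 1 ∨ σ = -1) → ∀ U : Finset (Fin n), U.Nonempty →
    pairSum ψ (u + bump U (σ * lam)) - pairSum ψ u ≤ γ * U.card

/-! ### Growth of superlevel sets and the oscillation bound -/

section Chain

variable {n : ℕ} {k : Pairs n → ℝ} {ψ : Pairs n → ℝ → ℝ} {u h : Fin n → ℝ}
  {lam L α β γ c₅ c₄ η σ : ℝ}

/-- The superlevel sets of an error vector that maximizes the likelihood in a box grow fast. -/
lemma IsExpanding.lt_card_superlevel (hE : IsExpanding k ψ u lam L α β γ) (hk : ∀ e, 0 ≤ k e)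
    (hlam : 0 ≤ lam) (hc₄ : 0 ≤ c₄) (hc₅ : 0 ≤ c₅) (hη0 : 0 ≤ η) (hσ : σ = 1 ∨ σ = -1)
    (hψ : ∀ e : Pairs n, CurvedAt (ψ e) (k e) (u e.1.1 - u e.1.2) lam c₅ c₄)
    (hη : γ + c₅ * lam ^ 2 * β < c₄ * lam * η * α)
    (hbox : ∀ i, |h i| ≤ 1 / 4)
    (hmax : ∀ w : Fin n → ℝ, (∀ i, |w i| ≤ 1 / 4) → pairSum ψ (u + w) ≤ pairSum ψ (u + h))
    {m : ℝ} (hm : -(1 / 4) + lam ≤ m) {U V : Finset (Fin n)} (hU : ∀ i, i ∈ U ↔ m ≤ σ * h i)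
    (hV : ∀ i, i ∈ V ↔ m - η ≤ σ * h i) (hne : U.Nonempty) (hUn : 2 * U.card ≤ n) :
    (n : ℝ) < 4 * (V.card - U.card) ∨ U.card * L < (V.card : ℝ) - U.card := by
  classical
  by_contra! hcon
  have hUV : U ⊆ V := fun i hi => (hV i).2 (by linarith [(hU i).1 hi])
  have hcard : ((V \ U).card : ℝ) = V.card - U.card := by
    rw [Finset.card_sdiff_of_subset hUV, Nat.cast_sub (Finset.card_le_card hUV)]
  -- With `W = V \ U` the complement of `U ∪ W` is `Vᶜ`, the set of vertices more than `η` below the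
  -- level.
  have h1 := hE.le_cut U (V \ U) hne hUn Finset.disjoint_sdiff
    (by exact_mod_cast (by rw [hcard]; exact hcon.1 : (4 : ℝ) * (V \ U).card ≤ n))
    (by rw [hcard]; exact hcon.2)
  have h2 := hE.cut_le U hne
  have h3 := hE.pairSum_le σ hσ U hne
  have hcomp : (U ∪ V \ U)ᶜ = Vᶜ := by rw [Finset.union_sdiff_of_subset hUV]
  rw [hcomp] at h1
  have hσh : ∀ i, |σ * h i| ≤ 1 / 4 := by
    intro i
    rcases hσ with rfl | rfl
    · simpa using hbox i
    · simpa using hbox i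
  have h4 := cut_le_of_pairSum_le (V := Vᶜ) (η := η) (h := h) hk hlam hc₄ hσ hψ
    (Finset.disjoint_left.2 fun i hi hi' => (Finset.mem_compl.1 hi') (hUV hi))
    (fun i hi j hj => by
      have := (hU i).1 hi
      have := mt (hU j).2 hj
      linarith)
    (fun i hi j hj => by
      have := abs_le.1 (hσh i)
      have := abs_le.1 (hσh j)
      linarith)
    (fun i hi j hj => by
      have := (hU i).1 hi
      have := mt (hV j).2 (Finset.mem_compl.1 hj)
      linarith)
    -- The lowered vector must stay in the box to compete with `h`; on `U` this is what `-(1/4) +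
    -- lam ≤ m` ensures.
    (hmax _ fun i => by
      have hb := abs_le.1 (hσh i)
      have e : |(h - bump U (σ * lam)) i| = |σ * (h - bump U (σ * lam)) i| := by
        rw [abs_mul]; rcases hσ with rfl | rfl <;> simp
      rw [e]
      by_cases hi : i ∈ U
      · have := (hU i).1 hi
        have e2 : σ * (h - bump U (σ * lam)) i = σ * h i - lam := by
          simp only [Pi.sub_apply, bump, hi, if_true]
          rcases hσ with rfl | rfl <;> ring
        rw [e2, abs_le]; constructor <;> linarith
      · simp only [Pi.sub_apply, bump, hi, if_false, sub_zero]; exact hσh i)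
  have hpos : (0 : ℝ) < U.card := by exact_mod_cast hne.card_pos
  have h5 : c₄ * lam * η * (α * U.card) ≤ c₄ * lam * η * cut k U Vᶜ := by gcongr
  have h6 : c₅ * lam ^ 2 * cut k U Uᶜ ≤ c₅ * lam ^ 2 * (β * U.card) := by gcongr
  nlinarith [mul_lt_mul_of_pos_right hη hpos]

/-- After sufficiently many steps down from the top, more than half of the vertices are reached. -/
lemma IsExpanding.half_lt_card_superlevel (hE : IsExpanding k ψ u lam L α β γ)
    (hk : ∀ e, 0 ≤ k e)
    (hlam : 0 ≤ lam) (hc₄ : 0 ≤ c₄) (hc₅ : 0 ≤ c₅) (hη0 : 0 ≤ η) (hσ : σ = 1 ∨ σ = -1)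
    (hL : 1 ≤ L)
    (hψ : ∀ e : Pairs n, CurvedAt (ψ e) (k e) (u e.1.1 - u e.1.2) lam c₅ c₄)
    (hη : γ + c₅ * lam ^ 2 * β < c₄ * lam * η * α)
    (hbox : ∀ i, |h i| ≤ 1 / 4)
    (hmax : ∀ w : Fin n → ℝ, (∀ i, |w i| ≤ 1 / 4) → pairSum ψ (u + w) ≤ pairSum ψ (u + h))
    {K : ℕ} (hK : (n : ℝ) ≤ L ^ K) (i₀ : Fin n) (hm : -(1 / 4) + lam ≤ σ * h i₀ - K * η) :
    n < 2 * (Finset.univ.filter fun i => σ * h i₀ - (K + 1 : ℕ) * η ≤ σ * h i).card := by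
  set S : ℕ → Finset (Fin n) :=
    fun j => Finset.univ.filter fun i => σ * h i₀ - j * η ≤ σ * h i with hS
  have hi₀ : ∀ j, i₀ ∈ S j := fun j => by
    simp only [hS, Finset.mem_filter, Finset.mem_univ, true_and]
    have : 0 ≤ j * η := by positivity
    linarith
  have hmono : ∀ j, S j ⊆ S (j + 1) := fun j i => by
    simp only [hS, Finset.mem_filter, Finset.mem_univ, true_and, Nat.cast_add, Nat.cast_one]
    intro hi; nlinarith
  have step : ∀ j ≤ K, 2 * (S j).card ≤ n →
      (n : ℝ) < 4 * ((S (j + 1)).card - (S j).card) ∨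
        (S j).card * L < ((S (j + 1)).card : ℝ) - (S j).card := by
    intro j hj hcard
    refine hE.lt_card_superlevel (m := σ * h i₀ - j * η) hk hlam hc₄ hc₅ hη0 hσ hψ hη hbox hmax
      ?_ (fun i => by simp [hS]) (fun i => ?_) ⟨i₀, hi₀ j⟩ hcard
    · have : (j : ℝ) * η ≤ K * η := by gcongr
      linarith
    · simp only [hS, Finset.mem_filter, Finset.mem_univ, true_and, Nat.cast_add, Nat.cast_one]
      rw [add_mul, one_mul, sub_sub]
  -- The first alternative persists, since the sets `S j` increase; until it occurs, each step
  -- multiplies the size by at least `L`.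
  have grow : ∀ j ≤ K, (n : ℝ) ≤ 4 * (S j).card ∨ L ^ j ≤ (S j).card := by
    intro j
    induction j with
    | zero =>
      intro _; right
      rw [pow_zero]
      exact_mod_cast Finset.card_pos.2 ⟨i₀, hi₀ 0⟩
    | succ j ih =>
      intro hj
      have hle : ((S j).card : ℝ) ≤ (S (j + 1)).card := by
        exact_mod_cast Finset.card_le_card (hmono j)
      rcases ih (by omega) with h1 | h1
      · left; linarith
      · by_cases hcard : 2 * (S j).card ≤ n
        · rcases step j (by omega) hcard with h2 | h2
          · left
            have : (0 : ℝ) ≤ (S j).card := by positivity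
            linarith
          · right
            have : L ^ j * L ≤ (S j).card * L := by gcongr
            rw [pow_succ]
            have : (0 : ℝ) ≤ (S j).card := by positivity
            linarith
        · left
          have : (n : ℝ) < 2 * (S j).card := by exact_mod_cast not_le.1 hcard
          linarith
  have hlast : (n : ℝ) ≤ 4 * (S K).card := by
    rcases grow K le_rfl with h1 | h1
    · exact h1
    · have : (0 : ℝ) ≤ (S K).card := by positivity
      linarith
  -- One further step passes from a quarter to more than a half: it either adds over `n/4` vertices
  -- or more than doubles the set.
  have hfin : (n : ℝ) < 2 * (S (K + 1)).card := by
    have hle : ((S K).card : ℝ) ≤ (S (K + 1)).card := by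
      exact_mod_cast Finset.card_le_card (hmono K)
    by_cases hcard : 2 * (S K).card ≤ n
    · rcases step K le_rfl hcard with h2 | h2
      · linarith
      · have : (S K).card * 1 ≤ (S K).card * L := by gcongr
        have hpos : (0 : ℝ) < n := by exact_mod_cast i₀.pos
        linarith
    · have : (n : ℝ) < 2 * (S K).card := by exact_mod_cast not_le.1 hcard
      linarith
  exact_mod_cast hfin

/-- The oscillation bound for an error vector that maximizes the likelihood in a box. -/
lemma IsExpanding.sub_le (hE : IsExpanding k ψ u lam L α β γ) (hk : ∀ e, 0 ≤ k e)
    (hlam : 0 ≤ lam) (hc₄ : 0 ≤ c₄) (hc₅ : 0 ≤ c₅) (hη0 : 0 ≤ η)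
    (hL : 1 ≤ L)
    (hψ : ∀ e : Pairs n, CurvedAt (ψ e) (k e) (u e.1.1 - u e.1.2) lam c₅ c₄)
    (hη : γ + c₅ * lam ^ 2 * β < c₄ * lam * η * α)
    (hbox : ∀ i, |h i| ≤ 1 / 4)
    (hmax : ∀ w : Fin n → ℝ, (∀ i, |w i| ≤ 1 / 4) → pairSum ψ (u + w) ≤ pairSum ψ (u + h))
    {K : ℕ} (hK : (n : ℝ) ≤ L ^ K) (i j : Fin n) :
    h i - h j ≤ 2 * (K + 1) * η + lam := by
  have hKη : 0 ≤ K * η := by positivity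
  by_cases h1 : -(1 / 4) + lam ≤ 1 * h i - K * η
  · by_cases h2 : -(1 / 4) + lam ≤ -1 * h j - K * η
    · have a1 := hE.half_lt_card_superlevel hk hlam hc₄ hc₅ hη0 (Or.inl rfl) hL hψ hη hbox hmax
        hK i h1
      have a2 := hE.half_lt_card_superlevel hk hlam hc₄ hc₅ hη0 (Or.inr rfl) hL hψ hη hbox hmax
        hK j h2
      have hlt : (Finset.univ : Finset (Fin n)).card <
          (Finset.univ.filter fun x => 1 * h i - (K + 1 : ℕ) * η ≤ 1 * h x).card +
            (Finset.univ.filter fun x => -1 * h j - (K + 1 : ℕ) * η ≤ -1 * h x).card := by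
        rw [Finset.card_univ, Fintype.card_fin]; omega
      obtain ⟨x, hx⟩ := Finset.inter_nonempty_of_card_lt_card_add_card
        (Finset.subset_univ _) (Finset.subset_univ _)
        hlt
      simp only [Finset.mem_inter, Finset.mem_filter, Finset.mem_univ, true_and, Nat.cast_add,
        Nat.cast_one] at hx
      linarith [hx.1, hx.2]
    -- If the chain would leave the box, the starting value is already within `K * η + lam` of the
    -- wall of the box, and so of every other value on that side.
    · have := (abs_le.1 (hbox i)).2
      linarith
  · have := (abs_le.1 (hbox j)).1
    linarith

end Chain

/-! ### Curvature of the log-likelihood -/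

/-- A function whose second derivative lies in `[-c₃, -c₄]` near `0` is quantitatively concave. -/
lemma sub_le_of_deriv2_bounds {G : ℝ → ℝ} (hG : Differentiable ℝ G)
    (hG' : Differentiable ℝ (deriv G)) {c₃ c₄ lam s : ℝ} (hlam : 0 ≤ lam) (hlam2 : lam ≤ 1 / 2)
    (hs : 0 ≤ s) (hs2 : s ≤ 1 / 2) (hc₃ : 0 ≤ c₃) (hc₄ : 0 ≤ c₄)
    (hl : ∀ z, |z| ≤ 1 / 2 → -c₃ ≤ deriv (deriv G) z)
    (hu : ∀ z, |z| ≤ 1 / 2 → deriv (deriv G) z ≤ -c₄) :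
    G s - G (s - lam) ≤ G lam - G 0 + lam * ((c₃ + c₄) * lam - c₄ * s) := by
  have hI : ∀ z, z ∈ Set.Icc (-(1 / 2) : ℝ) (1 / 2) ↔ |z| ≤ 1 / 2 := fun z => by
    rw [abs_le, Set.mem_Icc]
  have gu := (convex_Icc (-(1 / 2) : ℝ) (1 / 2)).image_sub_le_mul_sub_of_deriv_le
    hG'.continuous.continuousOn hG'.differentiableOn (C := -c₄)
    (fun z hz => hu z ((hI z).1 (interior_subset hz)))
  have gl := (convex_Icc (-(1 / 2) : ℝ) (1 / 2)).mul_sub_le_image_sub_of_le_deriv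
    hG'.continuous.continuousOn hG'.differentiableOn (C := -c₃)
    (fun z hz => hl z ((hI z).1 (interior_subset hz)))
  -- The claim compares `D (s - lam)` with `D 0`, and the slope of `D` lies in `[-c₃ * lam, -c₄ *
  -- lam]`. The upper bound serves for `lam ≤ s`, the lower one for `s ≤ lam`.
  set D : ℝ → ℝ := fun z => G (z + lam) - G z with hD
  have hDd : ∀ z, HasDerivAt D (deriv G (z + lam) - deriv G z) z := fun z =>
    ((hG (z + lam)).hasDerivAt.comp_add_const z lam).sub (hG z).hasDerivAt
  have hDdiff : Differentiable ℝ D := fun z => (hDd z).differentiableAt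
  have hmem : ∀ z ∈ interior (Set.Icc (-lam) (1 / 2 - lam)),
      z ∈ Set.Icc (-(1 / 2) : ℝ) (1 / 2) ∧ z + lam ∈ Set.Icc (-(1 / 2) : ℝ) (1 / 2) := by
    intro z hz
    obtain ⟨h1, h2⟩ := interior_subset hz
    exact ⟨⟨by linarith, by linarith⟩, ⟨by linarith, by linarith⟩⟩
  have du := (convex_Icc (-lam) (1 / 2 - lam)).image_sub_le_mul_sub_of_deriv_le
    hDdiff.continuous.continuousOn hDdiff.differentiableOn (C := -c₄ * lam)
    (fun z hz => by
      rw [(hDd z).deriv]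
      have := gu z (hmem z hz).1 _ (hmem z hz).2 (by linarith)
      linarith)
  have dl := (convex_Icc (-lam) (1 / 2 - lam)).mul_sub_le_image_sub_of_le_deriv
    hDdiff.continuous.continuousOn hDdiff.differentiableOn (C := -c₃ * lam)
    (fun z hz => by
      rw [(hDd z).deriv]
      have := gl z (hmem z hz).1 _ (hmem z hz).2 (by linarith)
      linarith)
  have m0 : (0 : ℝ) ∈ Set.Icc (-lam) (1 / 2 - lam) := ⟨by linarith, by linarith⟩
  have m1 : s - lam ∈ Set.Icc (-lam) (1 / 2 - lam) := ⟨by linarith, by linarith⟩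
  have p1 : 0 ≤ c₃ * lam * lam := by positivity
  have p2 : 0 ≤ c₃ * lam * s := by positivity
  rcases le_total lam s with hls | hls
  · have := du 0 m0 _ m1 (by linarith)
    simp only [hD, sub_add_cancel, zero_add] at this
    nlinarith
  · have := dl _ m1 0 m0 (by linarith)
    simp only [hD, sub_add_cancel, zero_add] at this
    have p3 : 0 ≤ c₄ * lam * (lam - s) := by
      have : 0 ≤ lam - s := by linarith
      positivity
    nlinarith

/-- Restricting to the line `z ↦ y + o * z` with `o = ±1` leaves second derivatives unchanged, as `o
* o = 1`. Shifts of at most `1/2` explain the margin in `|z| ≤ R + 1 / 2`. -/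
lemma StrictlyLogConcave.curvedAt_log {A : Set ℝ} {f : ℝ → ℝ → ℝ} (hlc : StrictlyLogConcave A f)
    {x y c₃ c₄ lam R : ℝ} (hx : x ∈ A) (hlam : 0 ≤ lam) (hlam2 : lam ≤ 1 / 2)
    (hc₃ : 0 ≤ c₃) (hc₄ : 0 ≤ c₄) (hy : |y| ≤ R)
    (hb : ∀ z, |z| ≤ R + 1 / 2 → c₄ ≤ |score₂ f x z| ∧ |score₂ f x z| ≤ c₃) :
    CurvedAt (fun z => Real.log (f x z)) 1 y lam (c₃ + c₄) c₄ := by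
  intro o ho s hs hs2
  have ho2 : o * o = 1 := by rcases ho with rfl | rfl <;> norm_num
  have hoa : |o| = 1 := by rcases ho with rfl | rfl <;> simp
  set φ : ℝ → ℝ := fun z => Real.log (f x z) with hφ
  have hlin : ∀ z, HasDerivAt (fun z => y + o * z) o z := fun z => by
    simpa using ((hasDerivAt_id z).const_mul o).const_add y
  have hd1 : ∀ z, HasDerivAt (fun z => φ (y + o * z)) (score f x (y + o * z) * o) z := fun z =>
    HasDerivAt.comp (h₂ := φ) z (hlc.differentiable_log x hx (y + o * z)).hasDerivAt (hlin z)
  have hderiv : deriv (fun z => φ (y + o * z)) = fun z => score f x (y + o * z) * o :=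
    funext fun z => (hd1 z).deriv
  have hd2 : ∀ z, HasDerivAt (fun z => score f x (y + o * z) * o) (score₂ f x (y + o * z)) z := by
    intro z
    have := ((hlc.differentiable_score x hx (y + o * z)).hasDerivAt.comp z (hlin z)).mul_const o
    rwa [mul_assoc, ho2, mul_one] at this
  have hneg : ∀ z, score₂ f x z = -|score₂ f x z| := fun z => by
    rw [abs_of_neg (hlc.score₂_neg x hx z), neg_neg]
  have hz : ∀ z : ℝ, |z| ≤ 1 / 2 → |y + o * z| ≤ R + 1 / 2 := fun z hz => by
    calc |y + o * z| ≤ |y| + |o * z| := abs_add_le _ _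
      _ ≤ R + 1 / 2 := by rw [abs_mul, hoa, one_mul]; linarith
  have := sub_le_of_deriv2_bounds (G := fun z => φ (y + o * z)) (c₃ := c₃) (c₄ := c₄)
    (fun z => (hd1 z).differentiableAt)
    (by rw [hderiv]; exact fun z => (hd2 z).differentiableAt) hlam hlam2 hs hs2 hc₃ hc₄
    (fun z h => by
      rw [hderiv, (hd2 z).deriv, hneg]
      exact neg_le_neg (hb _ (hz z h)).2)
    (fun z h => by
      rw [hderiv, (hd2 z).deriv, hneg]
      exact neg_le_neg (hb _ (hz z h)).1)
  simpa using this

lemma CurvedAt.sum {ι : Type*} {F : Finset ι} {φ : ι → ℝ → ℝ} {y lam c₅ c₄ : ℝ}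
    (h : ∀ t ∈ F, CurvedAt (φ t) 1 y lam c₅ c₄) :
    CurvedAt (fun z => ∑ t ∈ F, φ t z) F.card y lam c₅ c₄ := by
  intro o ho s hs hs2
  have := Finset.sum_le_sum fun t ht => h t ht o ho s hs hs2
  simp only [Finset.sum_sub_distrib, Finset.sum_add_distrib, Finset.sum_const, nsmul_eq_mul,
    one_mul] at this
  rw [mul_assoc]
  exact this

lemma StrictlyLogConcave.strictConcaveOn {A : Set ℝ} {f : ℝ → ℝ → ℝ}
    (hlc : StrictlyLogConcave A f) {x : ℝ} (hx : x ∈ A) :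
    StrictConcaveOn ℝ Set.univ fun y => Real.log (f x y) :=
  strictConcaveOn_univ_of_deriv2_neg (hlc.differentiable_log x hx).continuous
    fun y => hlc.score₂_neg x hx y

/-! ### Existence and uniqueness of the maximum likelihood estimator -/

/-- The indices of the observed comparisons of a pair. -/
def observed {n T : ℕ} (N : Fin n → Fin n → ℕ) (e : Pairs n) : Finset (Fin T) :=
  Finset.univ.filter fun t : Fin T => (t : ℕ) < N e.1.1 e.1.2

/-- The contribution of a pair to the log-likelihood. -/
def pairLogLik (f : ℝ → ℝ → ℝ) {n T : ℕ} (N : Fin n → Fin n → ℕ) (X : Fin n → Fin n → Fin T → ℝ)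
    (e : Pairs n) (y : ℝ) : ℝ :=
  ∑ t ∈ observed N e, Real.log (f (X e.1.1 e.1.2 t) y)

lemma logLik_eq_pairSum (f : ℝ → ℝ → ℝ) {n T : ℕ} (N : Fin n → Fin n → ℕ)
    (X : Fin n → Fin n → Fin T → ℝ) : logLik f N X = pairSum (pairLogLik f N X) := rfl

lemma exists_joins_of_cut_pos {n : ℕ} {k : Pairs n → ℝ} {U V : Finset (Fin n)}
    (h : 0 < cut k U V) :
    ∃ e, 0 < k e ∧ (e.1.1 ∈ U ∧ e.1.2 ∈ V ∨ e.1.2 ∈ U ∧ e.1.1 ∈ V) := by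
  by_contra! hcon
  refine absurd h (not_lt.2 (Finset.sum_nonpos fun e _ => ?_))
  split_ifs with he
  · by_contra! hk
    rcases he with he | he
    · exact (hcon e hk).1 he.1 he.2
    · exact (hcon e hk).2 he.1 he.2
  · exact le_rfl

/-- Connectedness of the comparison graph: the lower cut bound with `W = ∅` applies to whichever of
`U`, `Uᶜ` has at most half of the vertices. -/
lemma IsExpanding.exists_joins {n : ℕ} {k : Pairs n → ℝ} {ψ : Pairs n → ℝ → ℝ} {u : Fin n → ℝ}
    {lam L α β γ : ℝ} (hE : IsExpanding k ψ u lam L α β γ) (hα : 0 < α) (hL : 0 ≤ L)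
    {U : Finset (Fin n)} (hU : U.Nonempty) (hU' : Uᶜ.Nonempty) :
    ∃ e, 0 < k e ∧ (e.1.1 ∈ U ∧ e.1.2 ∉ U ∨ e.1.2 ∈ U ∧ e.1.1 ∉ U) := by
  have key : ∀ V : Finset (Fin n), V.Nonempty → 2 * V.card ≤ n → 0 < cut k V Vᶜ := by
    intro V hV hVn
    have := hE.le_cut V ∅ hV hVn (Finset.disjoint_empty_right _) (by simp)
      (by simp only [Finset.card_empty, Nat.cast_zero]; positivity)
    rw [Finset.union_empty] at this
    have hpos : (0 : ℝ) < V.card := by exact_mod_cast hV.card_pos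
    exact lt_of_lt_of_le (by positivity) this
  have hc := Finset.card_add_card_compl U
  rw [Fintype.card_fin] at hc
  by_cases hUn : 2 * U.card ≤ n
  · simpa using exists_joins_of_cut_pos (key U hU hUn)
  · obtain ⟨e, hk, he⟩ := exists_joins_of_cut_pos (key Uᶜ hU' (by omega))
    refine ⟨e, hk, ?_⟩
    simp only [Finset.mem_compl, not_not] at he
    tauto

lemma pairSum_add_const {n : ℕ} (ψ : Pairs n → ℝ → ℝ) (v : Fin n → ℝ) (c : ℝ) :
    pairSum ψ (fun i => v i + c) = pairSum ψ v := by
  simp [pairSum]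

section MLE

variable {A : Set ℝ} {f : ℝ → ℝ → ℝ} {n T : ℕ} {N : Fin n → Fin n → ℕ}
  {X : Fin n → Fin n → Fin T → ℝ}

lemma StrictlyLogConcave.concaveOn_pairLogLik (hlc : StrictlyLogConcave A f)
    (hX : ∀ i j, i < j → ∀ t, X i j t ∈ A) (e : Pairs n) :
    ConcaveOn ℝ Set.univ (pairLogLik f N X e) := by
  refine ⟨convex_univ, fun x _ y _ a b ha hb hab => ?_⟩
  simp only [pairLogLik, smul_eq_mul, Finset.mul_sum, ← Finset.sum_add_distrib]
  exact Finset.sum_le_sum fun t _ =>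
    (hlc.strictConcaveOn (hX _ _ e.2 t)).concaveOn.2 trivial trivial ha hb hab

lemma StrictlyLogConcave.strictConcaveOn_pairLogLik (hlc : StrictlyLogConcave A f)
    (hX : ∀ i j, i < j → ∀ t, X i j t ∈ A) (e : Pairs n)
    (he : (observed N e : Finset (Fin T)).Nonempty) :
    StrictConcaveOn ℝ Set.univ (pairLogLik f N X e) := by
  refine ⟨convex_univ, fun x _ y _ hxy a b ha hb hab => ?_⟩
  simp only [pairLogLik, smul_eq_mul, Finset.mul_sum, ← Finset.sum_add_distrib]
  exact Finset.sum_lt_sum_of_nonempty he fun t _ =>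
    (hlc.strictConcaveOn (hX _ _ e.2 t)).2 trivial trivial hxy ha hb hab

lemma StrictlyLogConcave.concaveOn_pairSum (hlc : StrictlyLogConcave A f)
    (hX : ∀ i j, i < j → ∀ t, X i j t ∈ A) :
    ConcaveOn ℝ Set.univ (pairSum (pairLogLik f N X)) := by
  refine ⟨convex_univ, fun x _ y _ a b ha hb hab => ?_⟩
  simp only [pairSum, smul_eq_mul, Finset.mul_sum, ← Finset.sum_add_distrib]
  refine Finset.sum_le_sum fun e _ => ?_
  have := (hlc.concaveOn_pairLogLik (N := N) hX e).2 (Set.mem_univ (x e.1.1 - x e.1.2))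
    (Set.mem_univ (y e.1.1 - y e.1.2)) ha hb hab
  simp only [smul_eq_mul] at this
  refine this.trans (le_of_eq ?_)
  congr 1
  simp only [Pi.add_apply, Pi.smul_apply, smul_eq_mul]
  ring

/-- On a connected comparison graph there is at most one maximum likelihood estimator. -/
lemma IsMLE.eq_of_isExpanding (hlc : StrictlyLogConcave A f)
    (hX : ∀ i j, i < j → ∀ t, X i j t ∈ A) (hn : 0 < n) {u : Fin n → ℝ}
    {lam L α β γ : ℝ}
    (hE : IsExpanding (fun e => ((observed N e : Finset (Fin T)).card : ℝ)) (pairLogLik f N X) u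
      lam L α β γ) (hα : 0 < α) (hL : 0 ≤ L) {v w : Fin n → ℝ} (hv : IsMLE f N X v)
    (hw : IsMLE f N X w) : w = v := by
  by_contra hne
  -- The set of agreement contains the first vertex by normalization. If it were proper, an observed
  -- pair would leave it, and strict concavity at that pair would make the midpoint of `v` and `w`
  -- better than both.
  set U : Finset (Fin n) := Finset.univ.filter fun i => v i = w i with hU
  have h0 : U.Nonempty := ⟨⟨0, hn⟩, by simp [hU, hv.1 ⟨0, hn⟩ rfl, hw.1 ⟨0, hn⟩ rfl]⟩
  have h1 : Uᶜ.Nonempty := by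
    by_contra hemp
    rw [Finset.not_nonempty_iff_eq_empty, Finset.compl_eq_empty_iff] at hemp
    refine hne (funext fun i => ?_)
    have : i ∈ U := hemp ▸ Finset.mem_univ i
    simpa [hU, eq_comm] using this
  obtain ⟨e, hke, he⟩ := hE.exists_joins hα hL h0 h1
  have hke' : (observed N e : Finset (Fin T)).Nonempty := by
    rw [← Finset.card_pos]; exact_mod_cast hke
  have hde : v e.1.1 - v e.1.2 ≠ w e.1.1 - w e.1.2 := by
    simp only [hU, Finset.mem_filter, Finset.mem_univ, true_and] at he
    intro h
    rcases he with ⟨a, b⟩ | ⟨a, b⟩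
    · exact b (by linarith)
    · exact b (by linarith)
  have hvw : logLik f N X v = logLik f N X w := le_antisymm (hw.2 v hv.1) (hv.2 w hw.1)
  set m : Fin n → ℝ := fun i => (1 / 2 : ℝ) * v i + (1 / 2) * w i with hm
  have hmn : m ∈ normalized n := fun i hi => by simp [hm, hv.1 i hi, hw.1 i hi]
  have hlt : (1 / 2 : ℝ) * logLik f N X v + (1 / 2) * logLik f N X w < logLik f N X m := by
    have hme : ∀ e : Pairs n, m e.1.1 - m e.1.2 =
        (1 / 2 : ℝ) * (v e.1.1 - v e.1.2) + (1 / 2) * (w e.1.1 - w e.1.2) := fun e => by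
      simp only [hm]; ring
    simp only [logLik_eq_pairSum, pairSum, Finset.mul_sum, ← Finset.sum_add_distrib, hme]
    refine Finset.sum_lt_sum (fun e _ => ?_) ⟨e, Finset.mem_univ _, ?_⟩
    · exact (hlc.concaveOn_pairLogLik hX e).2 trivial trivial (by norm_num) (by norm_num)
        (by norm_num)
    · exact (hlc.strictConcaveOn_pairLogLik hX e hke').2 trivial trivial hde (by norm_num)
        (by norm_num) (by norm_num)
  have := hv.2 m hmn
  linarith

/-- Existence of the maximum likelihood estimator, with an error bound. -/
lemma IsExpanding.exists_isMLE (hlc : StrictlyLogConcave A f)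
    (hX : ∀ i j, i < j → ∀ t, X i j t ∈ A) (hn : 0 < n) {u : Fin n → ℝ} (hu : u ∈ normalized n)
    {lam L α β γ c₅ c₄ η : ℝ}
    (hE : IsExpanding (fun e => ((observed N e : Finset (Fin T)).card : ℝ)) (pairLogLik f N X) u
      lam L α β γ) (hlam : 0 ≤ lam) (hc₄ : 0 ≤ c₄) (hc₅ : 0 ≤ c₅) (hη0 : 0 ≤ η) (hL : 1 ≤ L)
    (hψ : ∀ e : Pairs n, CurvedAt (pairLogLik f N X e)
      ((observed N e : Finset (Fin T)).card : ℝ) (u e.1.1 - u e.1.2) lam c₅ c₄)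
    (hη : γ + c₅ * lam ^ 2 * β < c₄ * lam * η * α) {K : ℕ} (hK : (n : ℝ) ≤ L ^ K)
    (hδ : 2 * (K + 1) * η + lam ≤ 1 / 8) :
    ∃ v, IsMLE f N X v ∧ ‖v - u‖ ≤ 2 * (K + 1) * η + lam := by
  have hcont : Continuous (pairSum (pairLogLik f N X)) := by
    refine continuous_finsetSum _ fun e _ => continuous_finsetSum _ fun t _ => ?_
    exact (hlc.differentiable_log _ (hX _ _ e.2 t)).continuous.comp
      ((continuous_apply _).sub (continuous_apply _))
  obtain ⟨h, hh, hmax⟩ := (isCompact_closedBall (0 : Fin n → ℝ) (1 / 4)).exists_isMaxOn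
    ⟨0, by simp⟩ ((hcont.comp (continuous_const.add continuous_id)).continuousOn :
      ContinuousOn (fun w => pairSum (pairLogLik f N X) (u + w)) _)
  have hball : ∀ w : Fin n → ℝ, w ∈ Metric.closedBall (0 : Fin n → ℝ) (1 / 4) ↔
      ∀ i, |w i| ≤ 1 / 4 := fun w => by
    rw [mem_closedBall_zero_iff, pi_norm_le_iff_of_nonneg (by norm_num)]
    rfl
  have hmax' : ∀ w : Fin n → ℝ, (∀ i, |w i| ≤ 1 / 4) →
      pairSum (pairLogLik f N X) (u + w) ≤ pairSum (pairLogLik f N X) (u + h) :=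
    fun w hw => hmax ((hball w).2 hw)
  have hosc := fun i j => hE.sub_le (h := h) (fun e => Nat.cast_nonneg _) hlam hc₄ hc₅ hη0 hL hψ hη
    ((hball h).1 hh) hmax' hK i j
  set δ : ℝ := 2 * (K + 1) * η + lam with hδdef
  have hδ0 : 0 ≤ δ := by positivity
  -- The likelihood is invariant under translation, so `u + h` may be shifted to vanish at the first
  -- vertex; the error is then bounded by the oscillation of `h`.
  set v : Fin n → ℝ := fun i => (u + h) i + -h ⟨0, hn⟩ with hv
  have hvu : ∀ i, |v i - u i| ≤ δ := fun i => by
    have h1 := hosc i ⟨0, hn⟩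
    have h2 := hosc ⟨0, hn⟩ i
    simp only [hv, Pi.add_apply]
    rw [abs_le]; constructor <;> linarith
  have hlv : pairSum (pairLogLik f N X) v = pairSum (pairLogLik f N X) (u + h) :=
    pairSum_add_const _ _ _
  -- A vector within `1/8` of `v` is within `1/8 + δ ≤ 1/4` of `u`, hence competes in the box.
  have hloc : IsLocalMax (pairSum (pairLogLik f N X)) v := by
    filter_upwards [Metric.ball_mem_nhds v (by norm_num : (0 : ℝ) < 1 / 8)] with w hw
    rw [hlv]
    have hw' := hmax' (w - u) fun i => by
      have h1 : |w i - v i| < 1 / 8 := lt_of_le_of_lt (dist_le_pi_dist w v i) hw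
      calc |(w - u) i| = |(w i - v i) + (v i - u i)| := by simp
        _ ≤ |w i - v i| + |v i - u i| := abs_add_le _ _
        _ ≤ 1 / 4 := by linarith [hvu i]
    rwa [add_sub_cancel] at hw'
  have hglob : ∀ w, pairSum (pairLogLik f N X) w ≤ pairSum (pairLogLik f N X) v :=
    IsMaxOn.of_isLocalMax_of_convex_univ hloc (hlc.concaveOn_pairSum hX)
  refine ⟨v, ⟨fun i hi => ?_, fun w _ => hglob w⟩, ?_⟩
  · have hi0 : i = ⟨0, hn⟩ := Fin.ext hi
    have := hu ⟨0, hn⟩ rfl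
    simp only [hv, Pi.add_apply, hi0]
    linarith
  · exact (pi_norm_le_iff_of_nonneg hδ0).2 hvu

end MLE

/-! ### Exponential bounds for sums over a random number of outcomes -/

section Chernoff

variable {Ω : Type*} [MeasurableSpace Ω] {P : Measure Ω}

lemma lintegral_prod_of_iIndepFun {κ : Type*} [Fintype κ] {Y : κ → Ω → ENNReal}
    (hY : iIndepFun Y P) (hm : ∀ i, AEMeasurable (Y i) P) :
    ∫⁻ ω, ∏ i, Y i ω ∂P = ∏ i, ∫⁻ ω, Y i ω ∂P := by
  have h := lintegral_prod_eq_prod_lintegral_of_indepFun Finset.univ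
    (fun i => (hm i).mk (Y i)) (hY.congr fun i => (hm i).ae_eq_mk) fun i => (hm i).measurable_mk
  rw [Finset.prod_congr rfl fun i _ => lintegral_congr_ae (hm i).ae_eq_mk, ← h]
  refine lintegral_congr_ae ?_
  filter_upwards [eventually_all.2 fun i => (hm i).ae_eq_mk] with ω hω
  exact Finset.prod_congr rfl fun i _ => hω i

/-- The probability generating function of the binomial law. -/
lemma sum_binomial_mul_pow (T : ℕ) (p : unitInterval) {m : ℝ} (hm : 0 ≤ m) :
    ∑ k ∈ Finset.range (T + 1), binomial T p {k} * ENNReal.ofReal m ^ k =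
      ENNReal.ofReal ((1 - p + p * m) ^ T) := by
  have h : ∀ k ∈ Finset.range (T + 1), binomial T p {k} * ENNReal.ofReal m ^ k =
      ENNReal.ofReal ((T.choose k * (p : ℝ) ^ k * (1 - p) ^ (T - k)) * m ^ k) := fun k _ => by
    rw [binomial_singleton, ← ENNReal.ofReal_pow hm, ← ENNReal.ofReal_mul binomial_nonneg]
  rw [Finset.sum_congr rfl h, ← ENNReal.ofReal_sum_of_nonneg fun k _ =>
    mul_nonneg binomial_nonneg (pow_nonneg hm k), add_comm (1 - (p : ℝ)), add_pow]
  congr 1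
  refine Finset.sum_congr rfl fun k _ => ?_
  rw [mul_pow]; ring

lemma prod_ite_lt {M : Type*} [CommMonoid M] {T k : ℕ} (hk : k ≤ T) (c : M) :
    ∏ t : Fin T, (if (t : ℕ) < k then c else 1) = c ^ k := by
  rw [Fin.prod_univ_eq_prod_range (fun t => if t < k then c else 1) T, Finset.prod_ite]
  have : (Finset.range T).filter (· < k) = Finset.range k := by
    ext t; simp only [Finset.mem_filter, Finset.mem_range]; omega
  simp [this]

variable {ι : Type*} [Fintype ι] {T : ℕ} {p : unitInterval}
  {N : ι → Ω → ℕ} {X : ι → Fin T → Ω → ℝ}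

/-- Splitting over the values `κ` of all counts turns the integrand into a sum of products of
functions of single independent variables. Resumming gives the binomial generating function `(1 - p
+ p m)^T ≤ exp (T p (m - 1))` for each index. -/
lemma lintegral_prod_count_le (hN : ∀ e, HasLaw (N e) (binomial T p) P)
    (hX : ∀ e t, AEMeasurable (X e t) P)
    (hind : iIndepFun (Sum.elim (fun (e : ι) (ω : Ω) => (N e ω : ℝ))
      (fun (a : ι × Fin T) (ω : Ω) => X a.1 a.2 ω)) P)
    {a : ι → ℝ → ENNReal} (ha : ∀ e, Measurable (a e)) {m : ι → ℝ} (hm : ∀ e, 0 ≤ m e)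
    (ham : ∀ e t, ∫⁻ ω, a e (X e t ω) ∂P ≤ ENNReal.ofReal (m e)) :
    ∫⁻ ω, ∏ e, ∏ t : Fin T, (if (t : ℕ) < N e ω then a e (X e t ω) else 1) ∂P ≤
      ENNReal.ofReal (Real.exp (∑ e, (T : ℝ) * p * (m e - 1))) := by
  classical
  have : IsProbabilityMeasure P := hind.isProbabilityMeasure
  have hae : ∀ᵐ ω ∂P, ∀ e, N e ω ≤ T := eventually_all.2 fun e => ae_le_of_hasLaw_binomial (hN e)
  -- On a count, `G κ` is the indicator of the value `κ e`; on an outcome, it is the factor `a` if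
  -- the outcome is observed under `κ`, and `1` otherwise.
  set G : (ι → ℕ) → ι ⊕ ι × Fin T → ℝ → ENNReal := fun κ => Sum.elim
    (fun e y => if y = (κ e : ℝ) then 1 else 0)
    (fun b x => if (b.2 : ℕ) < κ b.1 then a b.1 x else 1) with hG
  have hGm : ∀ κ s, Measurable (G κ s) := by
    rintro κ (e | b)
    · exact Measurable.ite (measurableSet_singleton _) measurable_const measurable_const
    · simp only [hG, Sum.elim_inr]
      split_ifs
      · exact ha _
      · exact measurable_const
  set Y : ι ⊕ ι × Fin T → Ω → ℝ := Sum.elim (fun (e : ι) (ω : Ω) => (N e ω : ℝ))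
      (fun (a : ι × Fin T) (ω : Ω) => X a.1 a.2 ω) with hY
  have hYm : ∀ s, AEMeasurable (Y s) P := by
    rintro (e | b)
    · exact (measurable_of_countable _).comp_aemeasurable (hN e).aemeasurable
    · exact hX _ _
  have expand : ∀ᵐ ω ∂P, ∏ e, ∏ t : Fin T, (if (t : ℕ) < N e ω then a e (X e t ω) else 1) =
      ∑ κ ∈ Fintype.piFinset fun _ : ι => Finset.range (T + 1), ∏ s, G κ s (Y s ω) := by
    filter_upwards [hae] with ω hω
    have h1 : ∀ e, ∏ t : Fin T, (if (t : ℕ) < N e ω then a e (X e t ω) else 1) =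
        ∑ k ∈ Finset.range (T + 1), (if (N e ω : ℝ) = k then 1 else 0) *
          ∏ t : Fin T, (if (t : ℕ) < k then a e (X e t ω) else 1) := fun e => by
      rw [Finset.sum_eq_single_of_mem (N e ω) (Finset.mem_range.2 (Nat.lt_succ_of_le (hω e)))]
      · simp
      · intro k _ hk
        rw [if_neg (by exact_mod_cast hk.symm), zero_mul]
    rw [Finset.prod_congr rfl fun e _ => h1 e, Finset.prod_univ_sum]
    refine Finset.sum_congr rfl fun κ _ => ?_
    rw [Fintype.prod_sum_type, Fintype.prod_prod_type, Finset.prod_mul_distrib]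
    rfl
  have hterm : ∀ κ, AEMeasurable (fun ω => ∏ s, G κ s (Y s ω)) P := fun κ =>
    Finset.aemeasurable_fun_prod _ fun s _ => (hGm κ s).comp_aemeasurable (hYm s)
  rw [lintegral_congr_ae expand, lintegral_finsetSum' _ fun κ _ => hterm κ]
  have term : ∀ κ ∈ Fintype.piFinset fun _ : ι => Finset.range (T + 1),
      ∫⁻ ω, ∏ s, G κ s (Y s ω) ∂P ≤ ∏ e, binomial T p {κ e} * ENNReal.ofReal (m e) ^ κ e := by
    intro κ hκ
    rw [lintegral_prod_of_iIndepFun (Y := fun s ω => G κ s (Y s ω))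
      (hind.comp (fun s => G κ s) (hGm κ)) fun s => (hGm κ s).comp_aemeasurable (hYm s),
      Fintype.prod_sum_type, Fintype.prod_prod_type, ← Finset.prod_mul_distrib]
    refine Finset.prod_le_prod' fun e _ => mul_le_mul' (le_of_eq ?_) ?_
    · have : ∀ ω, G κ (Sum.inl e) (Y (Sum.inl e) ω) =
          ({ω | N e ω = κ e} : Set Ω).indicator 1 ω := fun ω => by
        simp [hG, hY, Set.indicator_apply]
      rw [lintegral_congr this, lintegral_indicator_one₀]
      · exact (hN e).measure_eq (p := (· = κ e)) (MeasurableSet.of_discrete)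
      · exact (hN e).aemeasurable.nullMeasurableSet_preimage (measurableSet_singleton (κ e))
    · have hke : κ e ≤ T := Nat.lt_succ_iff.1 (Finset.mem_range.1 (Fintype.mem_piFinset.1 hκ e))
      rw [← prod_ite_lt hke (ENNReal.ofReal (m e))]
      refine Finset.prod_le_prod' fun t _ => ?_
      simp only [hG, hY, Sum.elim_inr]
      split_ifs
      · exact ham e t
      · simp
  refine (Finset.sum_le_sum term).trans ?_
  rw [← Finset.prod_univ_sum (fun _ : ι => Finset.range (T + 1))
    (fun e k => binomial T p {k} * ENNReal.ofReal (m e) ^ k), Real.exp_sum,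
    ENNReal.ofReal_prod_of_nonneg fun e _ => (Real.exp_pos _).le]
  refine Finset.prod_le_prod' fun e _ => ?_
  rw [sum_binomial_mul_pow T p (hm e)]
  refine ENNReal.ofReal_le_ofReal ?_
  rw [mul_assoc, Real.exp_nat_mul]
  have h0 : 0 ≤ 1 - (p : ℝ) + p * m e := add_nonneg (by linarith [p.2.2]) (mul_nonneg p.2.1 (hm e))
  refine pow_le_pow_left₀ h0 ?_ T
  linarith [Real.add_one_le_exp ((p : ℝ) * (m e - 1))]

/-- Chernoff's bound for a sum over randomly many independent outcomes. -/
lemma measure_le_sum_count_le (hN : ∀ e, HasLaw (N e) (binomial T p) P)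
    (hX : ∀ e t, AEMeasurable (X e t) P)
    (hind : iIndepFun (Sum.elim (fun (e : ι) (ω : Ω) => (N e ω : ℝ))
      (fun (a : ι × Fin T) (ω : Ω) => X a.1 a.2 ω)) P)
    {b : ι → ℝ → ℝ} (hb : ∀ e, Measurable (b e)) {m : ι → ℝ} (hm : ∀ e, 0 ≤ m e)
    (hbm : ∀ e t, ∫⁻ ω, ENNReal.ofReal (Real.exp (b e (X e t ω))) ∂P ≤ ENNReal.ofReal (m e))
    (θ : ℝ) :
    P {ω | θ ≤ ∑ e, ∑ t ∈ Finset.univ.filter (fun t : Fin T => (t : ℕ) < N e ω), b e (X e t ω)} ≤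
      ENNReal.ofReal (Real.exp (-θ + ∑ e, (T : ℝ) * p * (m e - 1))) := by
  have ha : ∀ e, Measurable fun x => ENNReal.ofReal (Real.exp (b e x)) := fun e =>
    (Real.measurable_exp.comp (hb e)).ennreal_ofReal
  have h1 := lintegral_prod_count_le hN hX hind ha hm hbm
  set S : Ω → ℝ := fun ω =>
    ∑ e, ∑ t ∈ Finset.univ.filter (fun t : Fin T => (t : ℕ) < N e ω), b e (X e t ω) with hS
  have h2 : ∀ ω, ∏ e, ∏ t : Fin T,
      (if (t : ℕ) < N e ω then ENNReal.ofReal (Real.exp (b e (X e t ω))) else 1) =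
        ENNReal.ofReal (Real.exp (S ω)) := fun ω => by
    simp only [hS, Real.exp_sum]
    rw [ENNReal.ofReal_prod_of_nonneg fun e _ => Finset.prod_nonneg fun t _ => (Real.exp_pos _).le]
    refine Finset.prod_congr rfl fun e _ => ?_
    rw [ENNReal.ofReal_prod_of_nonneg fun t _ => (Real.exp_pos _).le, Finset.prod_filter]
  have hmeas : AEMeasurable (fun ω => ENNReal.ofReal (Real.exp (S ω))) P := by
    simp only [← h2]
    refine Finset.aemeasurable_fun_prod _ fun e _ => Finset.aemeasurable_fun_prod _ fun t _ => ?_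
    have : (fun ω => if (t : ℕ) < N e ω then ENNReal.ofReal (Real.exp (b e (X e t ω))) else 1) =
        (fun q : ℕ × ℝ => if (t : ℕ) < q.1 then ENNReal.ofReal (Real.exp (b e q.2)) else 1) ∘
          fun ω => (N e ω, X e t ω) := rfl
    rw [this]
    refine Measurable.comp_aemeasurable ?_ ((hN e).aemeasurable.prodMk (hX e t))
    exact Measurable.ite (measurable_fst (MeasurableSet.of_discrete (s := {q : ℕ | (t : ℕ) < q})))
      ((ha e).comp measurable_snd) measurable_const
  -- Markov's inequality for `exp S`.
  have h3 := mul_meas_ge_le_lintegral₀ hmeas (ENNReal.ofReal (Real.exp θ))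
  simp only [h2] at h1
  have hset : {ω | θ ≤ S ω} =
      {ω | ENNReal.ofReal (Real.exp θ) ≤ ENNReal.ofReal (Real.exp (S ω))} := by
    ext ω
    simp [ENNReal.ofReal_le_ofReal_iff (Real.exp_pos _).le]
  rw [hset]
  have hpos : ENNReal.ofReal (Real.exp θ) ≠ 0 := by simp [Real.exp_pos]
  rw [Real.exp_add, ENNReal.ofReal_mul (Real.exp_pos _).le, Real.exp_neg,
    ENNReal.ofReal_inv_of_pos (Real.exp_pos _), mul_comm, ← div_eq_mul_inv,
    ENNReal.le_div_iff_mul_le (Or.inl hpos) (Or.inl ENNReal.ofReal_ne_top), mul_comm]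
  exact h3.trans h1

end Chernoff

/-! ### Likelihood ratio of one outcome -/

section Outcome

variable {ν : Measure ℝ} {A : Set ℝ} {f : ℝ → ℝ → ℝ}

/-- Nothing is assumed about `f` off `A`, so a function measurable on all of `ℝ` is obtained by
cutting off. -/
lemma IsValid.measurable_indicator (hf : IsValid ν A f) (y : ℝ) :
    Measurable (A.indicator fun x => f x y) := by
  refine measurable_of_restrict_of_restrict_compl hf.measurableSet ?_ ?_
  · convert hf.measurable y using 1
    ext x
    simp
  · convert (measurable_const : Measurable fun _ : (Aᶜ : Set ℝ) => (0 : ℝ)) using 1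
    ext x
    simp [Set.indicator_of_notMem x.2]

lemma IsValid.lintegral_eq_one (hf : IsValid ν A f) (y : ℝ) :
    ∫⁻ x in A, ENNReal.ofReal (f x y) ∂ν = 1 := by
  have h1 := hf.integral_eq_one y
  rw [← ofReal_integral_eq_lintegral_ofReal (integrable_of_integral_eq_one h1), h1,
    ENNReal.ofReal_one]
  exact (ae_restrict_mem hf.measurableSet).mono fun x hx => hf.nonneg x hx y

/-- The log-likelihood ratio of one outcome, extended by `0` outside `A`. -/
def logRatio (A : Set ℝ) (f : ℝ → ℝ → ℝ) (y' y x : ℝ) : ℝ :=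
  Real.log (A.indicator (fun x => f x y') x) - Real.log (A.indicator (fun x => f x y) x)

lemma IsValid.measurable_logRatio (hf : IsValid ν A f) (y' y : ℝ) :
    Measurable (logRatio A f y' y) :=
  (Real.measurable_log.comp (hf.measurable_indicator y')).sub
    (Real.measurable_log.comp (hf.measurable_indicator y))

/-- The likelihood ratio of one outcome has mean one. -/
lemma IsValid.lintegral_exp_logRatio (hf : IsValid ν A f) (hlc : StrictlyLogConcave A f)
    (y' y : ℝ) :
    ∫⁻ x, ENNReal.ofReal (Real.exp (logRatio A f y' y x)) ∂(outcomeLaw ν A f y) = 1 := by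
  have hcongr : (fun x => ENNReal.ofReal (f x y)) =ᵐ[ν.restrict A]
      fun x => ENNReal.ofReal (A.indicator (fun x => f x y) x) :=
    (ae_restrict_mem hf.measurableSet).mono fun x hx => by simp [Set.indicator_of_mem hx]
  have hm : Measurable fun x => ENNReal.ofReal (A.indicator (fun x => f x y) x) :=
    (hf.measurable_indicator y).ennreal_ofReal
  have hm2 : Measurable fun x => ENNReal.ofReal (Real.exp (logRatio A f y' y x)) :=
    (Real.measurable_exp.comp (hf.measurable_logRatio y' y)).ennreal_ofReal
  rw [outcomeLaw, withDensity_congr_ae hcongr, lintegral_withDensity_eq_lintegral_mul _ hm hm2,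
    ← hf.lintegral_eq_one y']
  refine lintegral_congr_ae ((ae_restrict_mem hf.measurableSet).mono fun x hx => ?_)
  simp only [Pi.mul_apply, logRatio, Set.indicator_of_mem hx]
  rw [← ENNReal.ofReal_mul (hlc.pos x hx y).le, Real.exp_sub, Real.exp_log (hlc.pos x hx y'),
    Real.exp_log (hlc.pos x hx y), mul_div_cancel₀ _ (hlc.pos x hx y).ne']

lemma IsValid.ae_mem_outcomeLaw (hf : IsValid ν A f) (y : ℝ) :
    ∀ᵐ x ∂(outcomeLaw ν A f y), x ∈ A :=
  (withDensity_absolutelyContinuous _ _).ae_le (ae_restrict_mem hf.measurableSet)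

end Outcome

open scoped Classical in
lemma card_joins {n : ℕ} {U V : Finset (Fin n)} (hUV : Disjoint U V) :
    (Finset.univ.filter fun e : Pairs n =>
      e.1.1 ∈ U ∧ e.1.2 ∈ V ∨ e.1.2 ∈ U ∧ e.1.1 ∈ V).card = U.card * V.card := by
  rw [← Finset.card_product]
  have hd : ∀ i, i ∈ U → i ∉ V := fun i hi => Finset.disjoint_left.1 hUV hi
  refine Finset.card_bij (fun e _ => if e.1.1 ∈ U then (e.1.1, e.1.2) else (e.1.2, e.1.1)) ?_ ?_ ?_
  · rintro e he
    simp only [Finset.mem_filter, Finset.mem_univ, true_and] at he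
    split_ifs with h
    · have := hd _ h
      rw [Finset.mem_product]
      tauto
    · rw [Finset.mem_product]
      tauto
  · rintro ⟨⟨i, j⟩, h⟩ _ ⟨⟨i', j'⟩, h'⟩ _ heq
    simp only at h h'
    rw [Subtype.mk.injEq]
    simp only at heq
    split_ifs at heq
    · exact heq
    · simp only [Prod.mk.injEq] at heq
      obtain ⟨rfl, rfl⟩ := heq
      exact absurd h' h.asymm
    · simp only [Prod.mk.injEq] at heq
      obtain ⟨rfl, rfl⟩ := heq
      exact absurd h' h.asymm
    · simp only [Prod.mk.injEq] at heq
      rw [heq.1, heq.2]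
  · rintro ⟨i, j⟩ hij
    rw [Finset.mem_product] at hij
    have hjU : j ∉ U := fun h => hd j h hij.2
    have hne : i ≠ j := fun h => hjU (h ▸ hij.1)
    rcases lt_or_gt_of_ne hne with h | h
    · exact ⟨⟨(i, j), h⟩, by simp [hij.1, hij.2], by simp [hij.1]⟩
    · exact ⟨⟨(j, i), h⟩, by simp [hij.1, hij.2], by simp [hjU]⟩

/-- The number of observed comparisons of each pair. -/
def weight {n : ℕ} (T : ℕ) (N : Fin n → Fin n → ℕ) (e : Pairs n) : ℝ :=
  ((observed N e : Finset (Fin T)).card : ℝ)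

/-! ### Probability that the data fail to expand -/

section Events

variable {Ω : Type*} [MeasurableSpace Ω] {P : Measure Ω} {ν : Measure ℝ}
  {A : Set ℝ} {f : ℝ → ℝ → ℝ} {T : ℕ} {p : unitInterval} {n : ℕ} {u : Fin n → ℝ}
  {N : Fin n → Fin n → Ω → ℕ} {X : Fin n → Fin n → Fin T → Ω → ℝ}

lemma IsComparisonData.ae_mem (h : IsComparisonData P ν A f T p u N X) (hf : IsValid ν A f) :
    ∀ᵐ ω ∂P, ∀ i j, i < j → ∀ t, X i j t ω ∈ A := by
  refine ae_all_iff.2 fun i => ae_all_iff.2 fun j => ?_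
  by_cases hij : i < j
  · have : ∀ᵐ ω ∂P, ∀ t, X i j t ω ∈ A := ae_all_iff.2 fun t =>
      ((h.outcome_law i j hij t).ae_iff (p := (· ∈ A)) hf.measurableSet.mem).2
        (hf.ae_mem_outcomeLaw _)
    exact this.mono fun ω hω _ => hω
  · exact Eventually.of_forall fun ω h' => absurd h' hij

/-- Chernoff's bound for the number of comparisons across a cut. -/
lemma IsComparisonData.measure_le_cut (h : IsComparisonData P ν A f T p u N X)
    {U V : Finset (Fin n)} (hUV : Disjoint U V) (ε θ : ℝ) :
    P {ω | θ ≤ ε * cut (weight T fun i j => N i j ω) U V} ≤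
      ENNReal.ofReal (Real.exp (-θ + T * p * (Real.exp ε - 1) * (U.card * V.card))) := by
  classical
  have : IsProbabilityMeasure P := h.indep.isProbabilityMeasure
  have key := measure_le_sum_count_le (N := fun (e : Pairs n) => N e.1.1 e.1.2)
    (X := fun (e : Pairs n) => X e.1.1 e.1.2) (fun e => h.count_law _ _ e.2)
    (fun e t => (h.outcome_law _ _ e.2 t).aemeasurable) h.indep
    (b := fun e _ => if e.1.1 ∈ U ∧ e.1.2 ∈ V ∨ e.1.2 ∈ U ∧ e.1.1 ∈ V then ε else 0)
    (fun e => measurable_const)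
    (m := fun e => if e.1.1 ∈ U ∧ e.1.2 ∈ V ∨ e.1.2 ∈ U ∧ e.1.1 ∈ V then Real.exp ε else 1)
    (fun e => by split_ifs <;> positivity)
    (fun e t => by split_ifs <;> simp) θ
  refine le_trans (le_of_eq ?_) (key.trans (le_of_eq ?_))
  · congr 1
    ext ω
    simp only [Set.mem_ofPred_eq, cut, weight, observed, Finset.sum_const, nsmul_eq_mul,
      Finset.mul_sum, mul_ite, mul_zero]
    refine iff_of_eq (congrArg _ (Finset.sum_congr rfl fun e _ => ?_))
    split_ifs
    · exact mul_comm _ _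
    · rfl
  · congr 3
    have e1 : ∀ e : Pairs n, (T : ℝ) * p *
        ((if e.1.1 ∈ U ∧ e.1.2 ∈ V ∨ e.1.2 ∈ U ∧ e.1.1 ∈ V then Real.exp ε else 1) - 1) =
        if e.1.1 ∈ U ∧ e.1.2 ∈ V ∨ e.1.2 ∈ U ∧ e.1.1 ∈ V then (T : ℝ) * p * (Real.exp ε - 1)
          else 0 := fun e => by split_ifs <;> simp
    rw [Finset.sum_congr rfl fun e _ => e1 e, ← Finset.sum_filter, Finset.sum_const,
      card_joins hUV, nsmul_eq_mul, Nat.cast_mul, mul_comm]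

/-- The likelihood of a fixed vector is unlikely to exceed that of the true scores by far. -/
lemma IsComparisonData.measure_le_pairSum_sub (h : IsComparisonData P ν A f T p u N X)
    (hf : IsValid ν A f) (hlc : StrictlyLogConcave A f) (w : Fin n → ℝ) (θ : ℝ) :
    P {ω | θ ≤ pairSum (pairLogLik f (fun i j => N i j ω) fun i j t => X i j t ω) w -
      pairSum (pairLogLik f (fun i j => N i j ω) fun i j t => X i j t ω) u} ≤
      ENNReal.ofReal (Real.exp (-θ)) := by
  have key := measure_le_sum_count_le (N := fun (e : Pairs n) => N e.1.1 e.1.2)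
    (X := fun (e : Pairs n) => X e.1.1 e.1.2) (fun e => h.count_law _ _ e.2)
    (fun e t => (h.outcome_law _ _ e.2 t).aemeasurable) h.indep
    (b := fun e => logRatio A f (w e.1.1 - w e.1.2) (u e.1.1 - u e.1.2))
    (fun e => hf.measurable_logRatio _ _)
    (m := fun _ => 1) (fun e => zero_le_one)
    (fun e t => by
      have hm : Measurable fun x => ENNReal.ofReal (Real.exp
          (logRatio A f (w e.1.1 - w e.1.2) (u e.1.1 - u e.1.2) x)) :=
        (Real.measurable_exp.comp (hf.measurable_logRatio _ _)).ennreal_ofReal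
      have hl := h.outcome_law _ _ e.2 t
      rw [← lintegral_map' (f := fun x => ENNReal.ofReal (Real.exp
        (logRatio A f (w e.1.1 - w e.1.2) (u e.1.1 - u e.1.2) x))) hm.aemeasurable
        hl.aemeasurable, hl.map_eq, hf.lintegral_exp_logRatio hlc, ENNReal.ofReal_one]) θ
  simp only [sub_self, mul_zero, Finset.sum_const_zero, add_zero] at key
  refine le_trans (measure_mono_ae ?_) key
  filter_upwards [h.ae_mem hf] with ω hω hθ
  change θ ≤ _
  refine le_trans hθ (le_of_eq ?_)
  simp only [pairSum, pairLogLik, ← Finset.sum_sub_distrib, observed]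
  refine Finset.sum_congr rfl fun e _ => Finset.sum_congr rfl fun t _ => ?_
  simp only [logRatio, Set.indicator_of_mem (hω _ _ e.2 t)]

lemma sum_pow_card (n : ℕ) (x : ℝ) : ∑ U : Finset (Fin n), x ^ U.card = (1 + x) ^ n := by
  have := Fintype.sum_pow_mul_eq_add_pow (Fin n) x 1
  simp only [one_pow, mul_one, Fintype.card_fin] at this
  rw [this, add_comm]

lemma sum_pow_card_nonempty (n : ℕ) (x : ℝ) :
    ∑ U ∈ Finset.univ.filter (fun U : Finset (Fin n) => U.Nonempty), x ^ U.card =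
      (1 + x) ^ n - 1 := by
  have h := Finset.sum_filter_add_sum_filter_not (Finset.univ : Finset (Finset (Fin n)))
    (fun U => U.Nonempty) fun U => x ^ U.card
  have h1 : (Finset.univ.filter fun U : Finset (Fin n) => ¬ U.Nonempty) = {∅} := by
    ext U; simp [Finset.not_nonempty_iff_eq_empty]
  rw [h1, Finset.sum_singleton, Finset.card_empty, pow_zero, sum_pow_card] at h
  linarith

/-- The comparison data are expanding up to an event of summable probability. -/
lemma IsComparisonData.measure_not_isExpanding_le (h : IsComparisonData P ν A f T p u N X)
    (hf : IsValid ν A f) (hlc : StrictlyLogConcave A f) (hT : 0 < T) (lam : ℝ) (hn : 0 < n)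
    (hℓ : 0 ≤ Real.log n) (hd : 48 * (1 + Real.log n) * Real.log n ≤ n * p) :
    P {ω | ¬ IsExpanding (weight T fun i j => N i j ω)
        (pairLogLik f (fun i j => N i j ω) fun i j t => X i j t ω) u lam (Real.log n)
        (n * p / 16) ((2 * T + 1) * (n * p)) (3 * Real.log n)} ≤
      ENNReal.ofReal (12 / (n : ℝ) ^ 2) := by
  -- Each bad event for `U` (and `W`) gets probability at most `x ^ (|U| + |W|)` with `x = n⁻³`, so
  -- the union bounds over all sets become binomial sums.
  set ℓ := Real.log n with hℓdef
  set x : ℝ := Real.exp (-(3 * ℓ)) with hx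
  have hx0 : 0 ≤ x := (Real.exp_pos _).le
  have hp0 : 0 ≤ (p : ℝ) := p.2.1
  have hT1 : (1 : ℝ) ≤ T := by exact_mod_cast hT
  have hn0 : (0 : ℝ) < n := by exact_mod_cast hn
  have hpow : ∀ s : ℕ, x ^ s = Real.exp (-(3 * ℓ * s)) := fun s => by
    rw [hx, ← Real.exp_nat_mul]; congr 1; ring
  set k : Ω → Pairs n → ℝ := fun ω => weight T fun i j => N i j ω with hk
  set l : Ω → (Fin n → ℝ) → ℝ := fun ω =>
    pairSum (pairLogLik f (fun i j => N i j ω) fun i j t => X i j t ω) with hl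
  set d : ℝ := n * p with hddef
  have hd0 : 0 ≤ d := by positivity
  set 𝒰 : Finset (Finset (Fin n)) := Finset.univ.filter fun U => U.Nonempty with h𝒰
  set E₁ : Finset (Fin n) → Finset (Fin n) → Set Ω := fun U W =>
    {ω | (Disjoint U W ∧ 2 * U.card ≤ n ∧ 4 * W.card ≤ n ∧ (W.card : ℝ) ≤ U.card * ℓ) ∧
      cut (k ω) U (U ∪ W)ᶜ < d / 16 * U.card} with hE₁
  set E₂ : Finset (Fin n) → Set Ω := fun U => {ω | (2 * T + 1) * d * U.card < cut (k ω) U Uᶜ}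
    with hE₂
  set E₃ : ℝ → Finset (Fin n) → Set Ω := fun σ U =>
    {ω | 3 * ℓ * U.card < l ω (u + bump U (σ * lam)) - l ω u} with hE₃
  have hsub : {ω | ¬ IsExpanding (k ω)
        (pairLogLik f (fun i j => N i j ω) fun i j t => X i j t ω) u lam ℓ
        (d / 16) ((2 * T + 1) * d) (3 * ℓ)} ⊆
      ((⋃ U ∈ 𝒰, ⋃ W ∈ (Finset.univ : Finset (Finset (Fin n))), E₁ U W) ∪ ⋃ U ∈ 𝒰, E₂ U) ∪
        ((⋃ U ∈ 𝒰, E₃ 1 U) ∪ ⋃ U ∈ 𝒰, E₃ (-1) U) := by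
    intro ω hω
    by_contra hcon
    simp only [Set.mem_union, Set.mem_iUnion, h𝒰, Finset.mem_filter, Finset.mem_univ, true_and,
      not_or, not_exists, exists_prop, not_and, hE₁, hE₂, hE₃, Set.mem_ofPred_eq, not_lt] at hcon
    obtain ⟨⟨h1, h2⟩, h3, h4⟩ := hcon
    refine hω ⟨fun U W hU hUn hUW hW hWL => h1 U hU W ⟨hUW, hUn, hW, hWL⟩, h2, ?_⟩
    rintro σ (rfl | rfl)
    · exact h3
    · exact h4
  have b₁ : ∀ U ∈ 𝒰, ∀ W ∈ (Finset.univ : Finset (Finset (Fin n))),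
      P (E₁ U W) ≤ ENNReal.ofReal (x ^ U.card * x ^ W.card) := by
    intro U hU W _
    by_cases hc : Disjoint U W ∧ 2 * U.card ≤ n ∧ 4 * W.card ≤ n ∧ (W.card : ℝ) ≤ U.card * ℓ
    · obtain ⟨hUW, hUn, hWn, hWL⟩ := hc
      have hdisj : Disjoint U (U ∪ W)ᶜ := Finset.disjoint_left.2 fun i hi hi' =>
        (Finset.mem_compl.1 hi') (Finset.mem_union_left _ hi)
      have hcard : (n : ℝ) / 4 ≤ ((U ∪ W)ᶜ.card : ℝ) := by
        have h1 := Finset.card_add_card_compl (U ∪ W)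
        rw [Fintype.card_fin] at h1
        have h2 : (U ∪ W).card = U.card + W.card := Finset.card_union_of_disjoint hUW
        have h3 : n ≤ 4 * (U ∪ W)ᶜ.card := by omega
        have : (n : ℝ) ≤ 4 * ((U ∪ W)ᶜ.card : ℝ) := by exact_mod_cast h3
        linarith
      refine le_trans (measure_mono fun ω hω => ?_)
        -- Lower tail, with `ε = -1`. At least `n/4` vertices lie outside `U ∪ W`, so the mean term
        -- is at most `-d|U|/8` and the exponent at most `-d|U|/16`. As `|W| ≤ ℓ|U|`, the entropy
        -- `3ℓ(|U| + |W|)` is at most `3ℓ(1 + ℓ)|U|`, whence the constant `48 = 3 * 16`.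
        ((h.measure_le_cut hdisj (-1) (-(d / 16 * U.card))).trans (ENNReal.ofReal_le_ofReal ?_))
      · have := hω.2
        change _ ≤ -1 * cut (k ω) U (U ∪ W)ᶜ
        linarith
      · rw [hpow, hpow, ← Real.exp_add]
        refine Real.exp_le_exp.2 ?_
        have he : Real.exp (-1) - 1 ≤ -(1 / 2) := by
          have := Real.exp_neg_one_lt_d9
          linarith
        have hs : (0 : ℝ) ≤ U.card := Nat.cast_nonneg _
        have h1 : (p : ℝ) * (1 / 2) * (U.card * (n / 4)) ≤
            (T : ℝ) * p * (1 - Real.exp (-1)) * (U.card * ((U ∪ W)ᶜ.card : ℝ)) := by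
          have : 1 / 2 ≤ 1 - Real.exp (-1) := by linarith
          have : (p : ℝ) ≤ (T : ℝ) * p := le_mul_of_one_le_left hp0 hT1
          gcongr
        have h2 : 3 * ℓ * W.card ≤ 3 * ℓ * (U.card * ℓ) := by gcongr
        have h3 := mul_le_mul_of_nonneg_right hd hs
        have h4 : (p : ℝ) * (1 / 2) * (U.card * (n / 4)) = d * U.card / 8 := by
          rw [hddef]; ring
        nlinarith
    · have : E₁ U W = ∅ := by
        ext ω
        simp only [hE₁, Set.mem_ofPred_eq, Set.mem_empty_iff_false, iff_false]
        exact fun h' => hc h'.1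
      rw [this, measure_empty]
      exact zero_le
  have b₂ : ∀ U ∈ 𝒰, P (E₂ U) ≤ ENNReal.ofReal (x ^ U.card) := by
    intro U _
    refine le_trans (measure_mono fun ω hω => ?_)
      -- Upper tail, with `ε = 1`: since `e - 1 ≤ 2`, the mean term is at most `2Td|U|`, and the
      -- threshold exceeds it by `d|U|`.
      ((h.measure_le_cut (disjoint_compl_right (a := U)) 1 ((2 * T + 1) * d * U.card)).trans
        (ENNReal.ofReal_le_ofReal ?_))
    · change _ ≤ 1 * cut (k ω) U Uᶜ
      rw [one_mul]
      exact le_of_lt hω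
    · rw [hpow]
      refine Real.exp_le_exp.2 ?_
      have he : Real.exp 1 - 1 ≤ 2 := by
        have := Real.exp_one_lt_d9
        linarith
      have he0 : 0 ≤ Real.exp 1 - 1 := by
        have := Real.add_one_le_exp 1
        linarith
      have hs : (0 : ℝ) ≤ U.card := Nat.cast_nonneg _
      have hc : (Uᶜ.card : ℝ) ≤ n := by
        have := Finset.card_le_univ Uᶜ
        rw [Fintype.card_fin] at this
        exact_mod_cast this
      have h1 : (T : ℝ) * p * (Real.exp 1 - 1) * (U.card * (Uᶜ.card : ℝ)) ≤
          (T : ℝ) * p * 2 * (U.card * n) := by gcongr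
      have h3 := mul_le_mul_of_nonneg_right hd hs
      have h5 : 0 ≤ ℓ * ℓ * U.card := by positivity
      have h6 : 0 ≤ ℓ * U.card := by positivity
      have h4 : (T : ℝ) * p * 2 * (U.card * n) = 2 * T * d * U.card := by
        rw [hddef]; ring
      nlinarith
  have b₃ : ∀ σ, ∀ U ∈ 𝒰, P (E₃ σ U) ≤ ENNReal.ofReal (x ^ U.card) := by
    intro σ U _
    rw [hpow]
    refine le_trans (measure_mono fun ω hω => ?_)
      (h.measure_le_pairSum_sub hf hlc (u + bump U (σ * lam)) (3 * ℓ * U.card))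
    change 3 * ℓ * U.card ≤ l ω (u + bump U (σ * lam)) - l ω u
    exact le_of_lt hω
  set B : ℝ := (1 + x) ^ n with hB
  have hB1 : 1 ≤ B := one_le_pow₀ (by linarith)
  have union_le : ∀ E : Finset (Fin n) → Set Ω, (∀ U ∈ 𝒰, P (E U) ≤ ENNReal.ofReal (x ^ U.card)) →
      P (⋃ U ∈ 𝒰, E U) ≤ ENNReal.ofReal (B - 1) := by
    intro E hE
    refine (measure_biUnion_finset_le _ _).trans ((Finset.sum_le_sum hE).trans (le_of_eq ?_))
    rw [← ENNReal.ofReal_sum_of_nonneg fun U _ => pow_nonneg hx0 _, h𝒰, sum_pow_card_nonempty]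
  have union₁ : P (⋃ U ∈ 𝒰, ⋃ W ∈ (Finset.univ : Finset (Finset (Fin n))), E₁ U W) ≤
      ENNReal.ofReal ((B - 1) * B) := by
    refine (measure_biUnion_finset_le _ _).trans ((Finset.sum_le_sum fun U hU =>
      (measure_biUnion_finset_le _ _).trans (Finset.sum_le_sum (b₁ U hU))).trans (le_of_eq ?_))
    have e1 : ∀ U : Finset (Fin n), ∑ W : Finset (Fin n),
        ENNReal.ofReal (x ^ U.card * x ^ W.card) = ENNReal.ofReal (x ^ U.card * B) := fun U => by
      rw [← ENNReal.ofReal_sum_of_nonneg fun W _ => by positivity, ← Finset.mul_sum, sum_pow_card]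
    rw [Finset.sum_congr rfl fun U _ => e1 U, ← ENNReal.ofReal_sum_of_nonneg fun U _ => by positivity,
      ← Finset.sum_mul, h𝒰, sum_pow_card_nonempty]
  refine (measure_mono hsub).trans ?_
  refine (measure_union_le _ _).trans ((add_le_add ((measure_union_le _ _).trans
    (add_le_add union₁ (union_le E₂ b₂))) ((measure_union_le _ _).trans
    (add_le_add (union_le _ (b₃ 1)) (union_le _ (b₃ (-1)))))).trans ?_)
  have hB0 : 0 ≤ B - 1 := by linarith
  rw [← ENNReal.ofReal_add (by positivity) hB0, ← ENNReal.ofReal_add hB0 hB0,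
    ← ENNReal.ofReal_add (by positivity) (by positivity)]
  refine ENNReal.ofReal_le_ofReal ?_
  -- The four unions total `(B - 1) * B + 3 * (B - 1)`; with `B - 1 ≤ 2 n x` and `n x ≤ 1` this is
  -- at most `12 n x`.
  have hnx : n * x = 1 / (n : ℝ) ^ 2 := by
    have : x = ((n : ℝ) ^ 3)⁻¹ := by
      have e : -(3 * ℓ) = -Real.log ((n : ℝ) ^ 3) := by rw [Real.log_pow]; norm_num [hℓdef]
      rw [hx, e, Real.exp_neg, Real.exp_log (by positivity)]
    rw [this]; field_simp
  have hBe : B ≤ Real.exp (n * x) := by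
    rw [Real.exp_nat_mul]
    exact pow_le_pow_left₀ (by linarith) (by linarith [Real.add_one_le_exp x]) n
  have hy1 : n * x ≤ 1 := by
    rw [hnx, div_le_one (by positivity)]
    exact one_le_pow₀ (by exact_mod_cast hn)
  have hy0 : 0 ≤ n * x := by positivity
  have hexp := Real.abs_exp_sub_one_le (x := n * x) (by rwa [abs_of_nonneg hy0])
  rw [abs_of_nonneg hy0] at hexp
  have hB2 : B - 1 ≤ 2 * (n * x) := by linarith [le_abs_self (Real.exp (n * x) - 1)]
  have h12 : 12 / (n : ℝ) ^ 2 = 12 * (n * x) := by rw [hnx]; ring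
  rw [h12]
  nlinarith

end Events

/-! ### Choice of parameters and the rate -/

/-- The number of steps is about `ℓ / log ℓ` and each has size `c / ℓ`, so the factors `ℓ` cancel
and `1 / log ℓ` is left. -/
lemma rate_le {ℓ c : ℝ} (hℓ : 1 < ℓ) (hc : 0 ≤ c) :
    2 * ((⌈ℓ / Real.log ℓ⌉₊ : ℝ) + 1) * (c * ℓ⁻¹) + ℓ⁻¹ ≤ (6 * c + 1) * (Real.log ℓ)⁻¹ := by
  have hg : 0 < Real.log ℓ := Real.log_pos hℓ
  have hgℓ : Real.log ℓ ≤ ℓ := (Real.log_le_sub_one_of_pos (by linarith)).trans (by linarith)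
  have hℓ0 : 0 < ℓ := by linarith
  have h1 : (⌈ℓ / Real.log ℓ⌉₊ : ℝ) ≤ ℓ / Real.log ℓ + 1 := (Nat.ceil_lt_add_one (by positivity)).le
  have h2 : ℓ⁻¹ ≤ (Real.log ℓ)⁻¹ := inv_anti₀ hg hgℓ
  calc 2 * ((⌈ℓ / Real.log ℓ⌉₊ : ℝ) + 1) * (c * ℓ⁻¹) + ℓ⁻¹
      ≤ 2 * ((ℓ / Real.log ℓ + 1) + 1) * (c * ℓ⁻¹) + ℓ⁻¹ := by gcongr
    _ = 2 * c * (Real.log ℓ)⁻¹ + (4 * c + 1) * ℓ⁻¹ := by field_simp; ring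
    _ ≤ 2 * c * (Real.log ℓ)⁻¹ + (4 * c + 1) * (Real.log ℓ)⁻¹ := by gcongr
    _ = (6 * c + 1) * (Real.log ℓ)⁻¹ := by ring

lemma le_log_pow_ceil {n : ℕ} (hn : 0 < n) (hℓ : 1 < Real.log n) :
    (n : ℝ) ≤ Real.log n ^ ⌈Real.log n / Real.log (Real.log n)⌉₊ := by
  have hg : 0 < Real.log (Real.log n) := Real.log_pos hℓ
  have hn0 : (0 : ℝ) < n := by exact_mod_cast hn
  rw [← Real.log_le_log_iff hn0 (by positivity), Real.log_pow]
  calc Real.log n = Real.log n / Real.log (Real.log n) * Real.log (Real.log n) := by field_simp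
    _ ≤ _ := by gcongr; exact Nat.le_ceil _

lemma abs_sub_le_dynamicRange {n : ℕ} (u : Fin n → ℝ) (i j : Fin n) :
    |u i - u j| ≤ dynamicRange u :=
  (le_ciSup (Set.finite_range fun j => |u i - u j|).bddAbove j).trans
    (le_ciSup (Set.finite_range fun i => ⨆ j, |u i - u j|).bddAbove i)

/-- Uniform bounds for the second derivative of the log-likelihood on a neighborhood of the range of
the relative scores. -/
lemma exists_score₂_bounds {A : Set ℝ} {f : ℝ → ℝ → ℝ}
    {u : (n : ℕ) → Fin n → ℝ}
    (hM : BddAbove (Set.range fun n => dynamicRange (u n)))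
    (hC3 : ∀ n, C3 A f (dynamicRange (u n)) < ⊤) (hC4 : ∀ n, 0 < C4 A f (dynamicRange (u n))) :
    ∃ M c₃ c₄ : ℝ, 0 ≤ c₃ ∧ 0 < c₄ ∧ (∀ n i j, |u n i - u n j| ≤ M) ∧
      ∀ x ∈ A, ∀ z, |z| ≤ M + 1 / 2 → c₄ ≤ |score₂ f x z| ∧ |score₂ f x z| ≤ c₃ := by
  set M : ℝ := ⨆ n, dynamicRange (u n) with hMdef
  -- One index with nearly maximal dynamic range suffices: its margin `1` covers the radius `M + 1 /
  -- 2`, so its constants serve for every `n`.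
  obtain ⟨n₀, hn₀⟩ := exists_lt_of_lt_ciSup (show M - 1 / 2 < ⨆ n, dynamicRange (u n) by
    rw [← hMdef]; linarith)
  obtain ⟨c₄, h0c₄, hc₄⟩ := ENNReal.lt_iff_exists_nnreal_btwn.1 (hC4 n₀)
  refine ⟨M, (C3 A f (dynamicRange (u n₀))).toReal, c₄, ENNReal.toReal_nonneg,
    by exact_mod_cast h0c₄, fun n i j => (abs_sub_le_dynamicRange _ i j).trans (le_ciSup hM n),
    fun x hx z hz => ?_⟩
  have hz' : |z| ≤ dynamicRange (u n₀) + 1 := by linarith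
  constructor
  · have h1 : C4 A f (dynamicRange (u n₀)) ≤ ENNReal.ofReal |score₂ f x z| :=
      iInf₂_le_of_le x hx (iInf₂_le z hz')
    have h2 := hc₄.le.trans h1
    rw [← ENNReal.ofReal_coe_nnreal] at h2
    exact (ENNReal.ofReal_le_ofReal_iff (abs_nonneg _)).1 h2
  · have h1 : ENNReal.ofReal |score₂ f x z| ≤ C3 A f (dynamicRange (u n₀)) :=
      le_iSup₂_of_le x hx (le_iSup₂ (f := fun (z : ℝ) (_ : |z| ≤ dynamicRange (u n₀) + 1) =>
        ENNReal.ofReal |score₂ f x z|) z hz')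
    exact (ENNReal.ofReal_le_iff_le_toReal (hC3 n₀).ne).1 h1

/-- The deterministic conclusion for one comparison graph: existence, uniqueness and rate. -/
lemma IsExpanding.exists_isMLE_of_log {A : Set ℝ} {f : ℝ → ℝ → ℝ} (hlc : StrictlyLogConcave A f)
    {n T : ℕ} {N : Fin n → Fin n → ℕ} {X : Fin n → Fin n → Fin T → ℝ}
    (hX : ∀ i j, i < j → ∀ t, X i j t ∈ A) (hn : 0 < n) {u : Fin n → ℝ} (hu : u ∈ normalized n)
    {M c₃ c₄ K d : ℝ} (hc₃ : 0 ≤ c₃) (hc₄ : 0 < c₄) (hK : 0 ≤ K) (huM : ∀ i j, |u i - u j| ≤ M)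
    (hb : ∀ x ∈ A, ∀ z, |z| ≤ M + 1 / 2 → c₄ ≤ |score₂ f x z| ∧ |score₂ f x z| ≤ c₃)
    (hℓ : 2 ≤ Real.log n) (hd : Real.log n ^ 3 ≤ K * d) (hd0 : 0 < d)
    {C : ℝ} (hC : C = 16 * (3 * K + (c₃ + c₄) * (2 * T + 1)) / c₄ + 1)
    (hsmall : (6 * C + 1) * (Real.log (Real.log n))⁻¹ ≤ 1 / 8)
    (hE : IsExpanding (weight T N) (pairLogLik f N X) u (Real.log n)⁻¹ (Real.log n) (d / 16)
      ((2 * T + 1) * d) (3 * Real.log n)) :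
    ∃ v, IsMLE f N X v ∧ (∀ w, IsMLE f N X w → w = v) ∧
      ‖v - u‖ ≤ (6 * C + 1) * (Real.log (Real.log n))⁻¹ := by
  set ℓ := Real.log n with hℓdef
  have hℓ0 : 0 < ℓ := by linarith
  have hC0 : 0 ≤ C := by rw [hC]; positivity
  have hrate := rate_le (ℓ := ℓ) (c := C) (by linarith) hC0
  have hlam : ℓ⁻¹ ≤ 1 / 2 := by
    rw [one_div]
    exact inv_anti₀ two_pos hℓ
  have hcurv : ∀ e : Pairs n, CurvedAt (pairLogLik f N X e)
      ((observed N e : Finset (Fin T)).card : ℝ) (u e.1.1 - u e.1.2) ℓ⁻¹ (c₃ + c₄) c₄ := fun e =>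
    CurvedAt.sum fun t _ => hlc.curvedAt_log (hX _ _ e.2 t) (by positivity) hlam hc₃ hc₄.le
      (huM _ _) (hb _ (hX _ _ e.2 t))
  -- Every term is measured against `d / ℓ²`; the cubic growth of `d` enters through `ℓ ≤ K d / ℓ²`.
  -- The summand `+ 1` in `C` makes the inequality strict.
  have hη : 3 * ℓ + (c₃ + c₄) * ℓ⁻¹ ^ 2 * ((2 * T + 1) * d) < c₄ * ℓ⁻¹ * (C * ℓ⁻¹) * (d / 16) := by
    have h1 : ℓ ≤ K * (d * ℓ⁻¹ ^ 2) := by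
      calc ℓ = ℓ ^ 3 * ℓ⁻¹ ^ 2 := by field_simp
        _ ≤ K * d * ℓ⁻¹ ^ 2 := by gcongr
        _ = _ := by ring
    have h2 : c₄ * ℓ⁻¹ * (C * ℓ⁻¹) * (d / 16) =
        (3 * K + (c₃ + c₄) * (2 * T + 1) + c₄ / 16) * (d * ℓ⁻¹ ^ 2) := by
      rw [hC]; field_simp
    have h3 : 0 < c₄ / 16 * (d * ℓ⁻¹ ^ 2) := by positivity
    rw [h2]
    nlinarith
  obtain ⟨v, hv, hvu⟩ := hE.exists_isMLE hlc hX hn hu (η := C * ℓ⁻¹) (by positivity) hc₄.le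
    (by positivity) (by positivity) (by linarith) hcurv hη
    (le_log_pow_ceil hn (by linarith)) (hrate.trans hsmall)
  exact ⟨v, hv, fun w hw => hv.eq_of_isExpanding hlc hX hn hE (by positivity) hℓ0.le hw,
    hvu.trans hrate⟩

/-! ### Borel–Cantelli and conclusion -/

/-- Almost surely, the comparison data are expanding for all large `n`. -/
lemma ae_eventually_isExpanding {ν : Measure ℝ} {A : Set ℝ} {f : ℝ → ℝ → ℝ}
    (hf : IsValid ν A f) (hlc : StrictlyLogConcave A f) {T : ℕ} (hT : 0 < T)
    {p : ℕ → unitInterval} {u : (n : ℕ) → Fin n → ℝ} {Ω : Type*} [MeasurableSpace Ω]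
    {P : Measure Ω} {N : (n : ℕ) → Fin n → Fin n → Ω → ℕ}
    {X : (n : ℕ) → Fin n → Fin n → Fin T → Ω → ℝ}
    (hdata : ∀ n, IsComparisonData P ν A f T (p n) (u n) (N n) (X n)) (lam : ℕ → ℝ)
    (hp : ∀ᶠ n : ℕ in atTop, 48 * (1 + Real.log n) * Real.log n ≤ n * p n) :
    ∀ᵐ ω ∂P, ∀ᶠ n : ℕ in atTop, IsExpanding (weight T fun i j => N n i j ω)
      (pairLogLik f (fun i j => N n i j ω) fun i j t => X n i j t ω) (u n) (lam n) (Real.log n)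
      (n * p n / 16) ((2 * T + 1) * (n * p n)) (3 * Real.log n) := by
  obtain ⟨n₀, hn₀⟩ := eventually_atTop.1 (hp.and (eventually_gt_atTop 0))
  -- Including `n₀ ≤ n` empties the events at small `n`, where no probability bound is available; at
  -- `n = 0` the majorant `12 / n ^ 2` is `0` by convention.
  set S : ℕ → Set Ω := fun n => {ω | n₀ ≤ n ∧ ¬ IsExpanding (weight T fun i j => N n i j ω)
      (pairLogLik f (fun i j => N n i j ω) fun i j t => X n i j t ω) (u n) (lam n) (Real.log n)
      (n * p n / 16) ((2 * T + 1) * (n * p n)) (3 * Real.log n)} with hS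
  have hle : ∀ n, P (S n) ≤ ENNReal.ofReal (12 / (n : ℝ) ^ 2) := fun n => by
    by_cases h : n₀ ≤ n
    · refine (measure_mono fun ω hω => ?_).trans ((hdata n).measure_not_isExpanding_le hf hlc hT
        (lam n) (hn₀ n h).2 (Real.log_natCast_nonneg n) (hn₀ n h).1)
      exact hω.2
    · have : S n = ∅ := by
        ext ω
        simp [hS, h]
      simp [this]
  have hsum : Summable fun n : ℕ => 12 / (n : ℝ) ^ 2 := by
    simpa [div_eq_mul_inv] using (Real.summable_nat_pow_inv.2 (by norm_num : 1 < 2)).mul_left 12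
  have hfin : ∑' n, P (S n) ≠ ⊤ :=
    ne_top_of_le_ne_top hsum.tsum_ofReal_ne_top (ENNReal.tsum_le_tsum hle)
  filter_upwards [ae_eventually_notMem hfin] with ω hω
  filter_upwards [hω, eventually_ge_atTop n₀] with n hn hn'
  by_contra hcon
  exact hn ⟨hn', hcon⟩

end PairwiseComparison

end

theorem mainTheorem4
    (ν : Measure ℝ) [ν.IsNegInvariant] (A : Set ℝ) (f : ℝ → ℝ → ℝ)
    (hf : PairwiseComparison.IsValid ν A f) (hlc : PairwiseComparison.StrictlyLogConcave A f)
    (T : ℕ) (hT : 0 < T) (p : ℕ → unitInterval)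
    (u : (n : ℕ) → Fin n → ℝ) (hu : ∀ n, u n ∈ PairwiseComparison.normalized n)
    (hM : BddAbove (Set.range fun n => PairwiseComparison.dynamicRange (u n)))
    (hC2 : ∀ n, PairwiseComparison.C2 A f (PairwiseComparison.dynamicRange (u n)) < ⊤)
    (hC3 : ∀ n, PairwiseComparison.C3 A f (PairwiseComparison.dynamicRange (u n)) < ⊤)
    (hC4 : ∀ n, 0 < PairwiseComparison.C4 A f (PairwiseComparison.dynamicRange (u n)))
    (hp : ∃ K : ℝ, ∀ᶠ n : ℕ in atTop, Real.log n ^ 3 / n ≤ K * (p n : ℝ))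
    {Ω : Type*} [MeasurableSpace Ω] (P : Measure Ω) [IsProbabilityMeasure P]
    (N : (n : ℕ) → Fin n → Fin n → Ω → ℕ) (X : (n : ℕ) → Fin n → Fin n → Fin T → Ω → ℝ)
    (hdata : ∀ n, PairwiseComparison.IsComparisonData P ν A f T (p n) (u n) (N n) (X n)) :
    ∃ C : ℝ, ∀ᵐ ω ∂P,
      (∀ᶠ n in atTop, ∃! v : Fin n → ℝ,
        PairwiseComparison.IsMLE f (fun i j => N n i j ω) (fun i j t => X n i j t ω) v) ∧
      ∀ uhat : (n : ℕ) → Fin n → ℝ,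
        (∀ᶠ n in atTop, PairwiseComparison.IsMLE f
          (fun i j => N n i j ω) (fun i j t => X n i j t ω) (uhat n)) →
        Tendsto (fun n => ‖uhat n - u n‖) atTop (𝓝 0) ∧
        ∀ᶠ n : ℕ in atTop, ‖uhat n - u n‖ ≤ C * (Real.log (Real.log n))⁻¹ := by
  obtain ⟨M, c₃, c₄, hc₃, hc₄, huM, hb⟩ :=
    PairwiseComparison.exists_score₂_bounds (u := u) hM hC3 hC4
  obtain ⟨K₀, hK₀⟩ := hp
  -- A positive constant allows cancelling `K` when the quadratic lower bound on `n p` is derived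
  -- from the cubic one.
  set K : ℝ := max K₀ 1 with hK
  have hK1 : 1 ≤ K := le_max_right _ _
  set C : ℝ := 16 * (3 * K + (c₃ + c₄) * (2 * T + 1)) / c₄ + 1 with hC
  have hlog : Tendsto (fun n : ℕ => Real.log n) atTop atTop :=
    Real.tendsto_log_atTop.comp tendsto_natCast_atTop_atTop
  have hloglog : Tendsto (fun n : ℕ => (6 * C + 1) * (Real.log (Real.log n))⁻¹) atTop (𝓝 0) := by
    have := (tendsto_inv_atTop_zero.comp (Real.tendsto_log_atTop.comp hlog)).const_mul (6 * C + 1)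
    rwa [mul_zero] at this
  have hd : ∀ᶠ n : ℕ in atTop, Real.log n ^ 3 ≤ K * (n * p n) := by
    filter_upwards [hK₀, eventually_gt_atTop 0] with n hn hn0
    have hn0' : (0 : ℝ) < n := by exact_mod_cast hn0
    rw [div_le_iff₀ hn0'] at hn
    have : K₀ * (p n : ℝ) * n ≤ K * (p n : ℝ) * n := by
      have := (p n).2.1
      gcongr
      exact le_max_left _ _
    linarith
  have hpn : ∀ᶠ n : ℕ in atTop, 48 * (1 + Real.log n) * Real.log n ≤ n * p n := by
    filter_upwards [hd, hlog.eventually_ge_atTop (96 * K)] with n hn hℓ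
    have h1 : 1 ≤ Real.log n := by linarith
    have h2 : K * (48 * (1 + Real.log n) * Real.log n) ≤ K * (n * p n) := by
      calc K * (48 * (1 + Real.log n) * Real.log n)
          ≤ K * (48 * (Real.log n + Real.log n) * Real.log n) := by gcongr
        _ = 96 * K * Real.log n ^ 2 := by ring
        _ ≤ Real.log n * Real.log n ^ 2 := by gcongr
        _ = Real.log n ^ 3 := by ring
        _ ≤ _ := hn
    exact le_of_mul_le_mul_left h2 (by linarith)
  refine ⟨6 * C + 1, ?_⟩
  filter_upwards [PairwiseComparison.ae_eventually_isExpanding hf hlc hT hdata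
    (fun n => (Real.log n)⁻¹) hpn, ae_all_iff.2 fun n => (hdata n).ae_mem hf] with ω hE hX
  have main : ∀ᶠ n in atTop, ∃ v : Fin n → ℝ,
      PairwiseComparison.IsMLE f (fun i j => N n i j ω) (fun i j t => X n i j t ω) v ∧
      (∀ w, PairwiseComparison.IsMLE f (fun i j => N n i j ω) (fun i j t => X n i j t ω) w →
        w = v) ∧ ‖v - u n‖ ≤ (6 * C + 1) * (Real.log (Real.log n))⁻¹ := by
    filter_upwards [hE, hd, hpn, hlog.eventually_ge_atTop 2, eventually_gt_atTop 0,
      hloglog.eventually_le_const (by norm_num : (0 : ℝ) < 1 / 8)] with n h1 h2 h3 h4 h5 h6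
    refine h1.exists_isMLE_of_log hlc (hX n) h5 (hu n) hc₃ hc₄ (by linarith) (huM n) hb h4 h2 ?_
      hC h6
    exact lt_of_lt_of_le (by positivity) h3
  refine ⟨main.mono fun n ⟨v, hv, huniq, _⟩ => ⟨v, hv, huniq⟩, fun uhat huhat => ?_⟩
  have hbound : ∀ᶠ n : ℕ in atTop,
      ‖uhat n - u n‖ ≤ (6 * C + 1) * (Real.log (Real.log n))⁻¹ := by
    filter_upwards [main, huhat] with n ⟨v, _, huniq, hv⟩ hn
    rw [huniq _ hn]
    exact hv
  exact ⟨squeeze_zero' (Eventually.of_forall fun n => norm_nonneg _) hbound hloglog, hbound⟩
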